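/- Let $N\ge 1$ and $M\ge 0$ be integers, and let $\lambda,\mu$ be partitions with conjugates $\lambda',\mu'$, where $\lambda'_1+\lambda'_2\le N+M$. Let $\omega=\{(i,j): i\ge 1,\ \lambda_i\ge j>\mu_i\}$ be the corresponding skew Young diagram, $n=|\omega|$, and let $\Omega$ be its column tableau: the boxes of $\omega$ (box $(i,j)$ lying in row $i$ and column $j$) are filled with $1,\dots,n$ consecutively by columns from left to right, downwards in every column. Put $c_k=j-i$ if the box $(i,j)$ is filled with $k$. On $(\mathbb C^N)^{\otimes n}$ let $P_{kl}$ be the operator exchanging the $k$th and $l$th tensor factors, and let $Q_{kl}$ be the operator acting as $u\otimes v\mapsto\langle u,v\rangle\sum_{i=1}^N e_i\otimes e_i$ in the $k$th and $l$th tensor factors and as the identity in the others, where $e_1,\dots,e_N$ is the standard basis of $\mathbb C^N$ and $\langle\,,\rangle$ is the symmetric bilinear form with $\langle e_i,e_j\rangle=\delta_{ij}$. Let $t_1,\dots,t_n$ be complex variables subject only to the constraints $t_k=t_l$ whenever $k$ and $l$ are in the same column of $\Omega$. Consider the operator-valued rational functions of these constrained variables $$R(t)=\prod^{\longrightarrow}_{1\le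 k<l\le n}\Bigl(1-\frac{P_{kl}}{c_k-c_l+t_k-t_l}\Bigr),\qquad K(t)=\prod^{\longrightarrow}_{1\le k<l\le n}\Bigl(1-\frac{Q_{kl}}{c_k+c_l+t_k+t_l+N+M}\Bigr),$$ where in products with an arrow to the right the pairs $(k,l)$ are ordered lexicographically, and in products with an arrow to the left they are in the reverse order. The function $R(t)$ is regular at the points with $t_1=\dots=t_n$ and has the same value $E_\Omega$ at all of them. If $k$ and $l$ are in different columns of $\Omega$, then $c_k+c_l+N+M-1\ne 0$. The rational function $K(t)R(t)$ is regular at $t_1=\dots=t_n=-\frac12$, and its value there is $$\prod^{\longrightarrow}_{(k,l)}\Bigl(1-\frac{Q_{kl}}{c_k+c_l+N+M-1}\Bigr)\cdot E_\Omega\;=\;E_\Omega\cdot\prod^{\longleftarrow}_{(k,l)}\Bigl(1-\frac{Q_{kl}}{c_k+c_l+N+M-1}\Bigr),$$ where both products are over all pairs $k<l$ such that $k$ and $l$ are in different columns of $\Omega$. This operator $F_\Omega(M)$ belongs to the Brauer centralizer algebra, the algebra of operators on $(\mathbb C^N)^{\otimes n}$ generated by all $P_{kl}$ and $Q_{kl}$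 with $1\le k<l\le n$. -/

import Mathlib

open scoped TensorProduct

noncomputable section

namespace BrauerFusion

/-! ### Operator-valued rational functions and their values -/

/-- The field of rational functions over `ℂ` in the variables indexed by `σ`. -/
abbrev RatField (σ : Type) : Type := FractionRing (MvPolynomial σ ℂ)

/-- The variable `t_j`, as a rational function. -/
def ratVar {σ : Type} (j : σ) : RatField σ :=
  algebraMap (MvPolynomial σ ℂ) (RatField σ) (MvPolynomial.X j)

section RationalFunctions

variable {σ : Type} {A : Type} [Ring A] [Algebra ℂ A]

/-- `A`-valued polynomials as `A`-valued rational functions. -/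
def polyToRat (σ : Type) (A : Type) [Ring A] [Algebra ℂ A] :
    MvPolynomial σ ℂ ⊗[ℂ] A →ₐ[ℂ] RatField σ ⊗[ℂ] A :=
  Algebra.TensorProduct.map
    (IsScalarTower.toAlgHom ℂ (MvPolynomial σ ℂ) (RatField σ)) (AlgHom.id ℂ A)

/-- Evaluation of an `A`-valued polynomial at a point. -/
def polyEval (A : Type) [Ring A] [Algebra ℂ A] (p : σ → ℂ) :
    MvPolynomial σ ℂ ⊗[ℂ] A →ₐ[ℂ] A :=
  (Algebra.TensorProduct.lid ℂ A).toAlgHom.comp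
    (Algebra.TensorProduct.map (MvPolynomial.aeval p) (AlgHom.id ℂ A))

/-- The `A`-valued rational function `F` is regular at the point `p` and has the value `v` there:
`F = G / g` for an `A`-valued polynomial `G` and a polynomial `g` with `g(p) ≠ 0`,
and `v = G(p) / g(p)`. -/
def HasValueAt (F : RatField σ ⊗[ℂ] A) (p : σ → ℂ) (v : A) : Prop :=
  ∃ (g : MvPolynomial σ ℂ) (G : MvPolynomial σ ℂ ⊗[ℂ] A),
    MvPolynomial.eval p g ≠ 0 ∧
    algebraMap (MvPolynomial σ ℂ) (RatField σ) g • F = polyToRat σ A G ∧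
    v = (MvPolynomial.eval p g)⁻¹ • polyEval A p G

theorem polyToRat_injective : Function.Injective (polyToRat σ A) := by
  have h : Function.Injective
      (IsScalarTower.toAlgHom ℂ (MvPolynomial σ ℂ) (RatField σ)).toLinearMap :=
    IsFractionRing.injective (MvPolynomial σ ℂ) (RatField σ)
  exact Module.Flat.rTensor_preserves_injective_linearMap (M := A) _ h

theorem polyToRat_smul (g : MvPolynomial σ ℂ) (G : MvPolynomial σ ℂ ⊗[ℂ] A) :
    polyToRat σ A (g • G) = algebraMap (MvPolynomial σ ℂ) (RatField σ) g • polyToRat σ A G := by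
  induction G with
  | zero => simp
  | add x y hx hy => rw [smul_add, map_add, hx, hy, map_add, smul_add]
  | tmul x a => simp [polyToRat, TensorProduct.smul_tmul', smul_eq_mul, Algebra.smul_def]

theorem polyEval_smul (p : σ → ℂ) (g : MvPolynomial σ ℂ) (G : MvPolynomial σ ℂ ⊗[ℂ] A) :
    polyEval A p (g • G) = MvPolynomial.eval p g • polyEval A p G := by
  induction G with
  | zero => simp
  | add x y hx hy => rw [smul_add, map_add, hx, hy, map_add, smul_add]
  | tmul x a => simp [polyEval, TensorProduct.smul_tmul', MvPolynomial.aeval_eq_eval, mul_smul]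

/-- A rational function has at most one value at a point. -/
theorem HasValueAt.unique {F : RatField σ ⊗[ℂ] A} {p : σ → ℂ} {v w : A}
    (hv : HasValueAt F p v) (hw : HasValueAt F p w) : v = w := by
  obtain ⟨g, G, hg, hG, rfl⟩ := hv
  obtain ⟨h, H, hh, hH, rfl⟩ := hw
  have key : h • G = g • H := by
    apply polyToRat_injective
    rw [polyToRat_smul, polyToRat_smul, ← hG, ← hH, smul_smul, smul_smul, mul_comm]
  have key2 := congrArg (polyEval A p) key
  rw [polyEval_smul, polyEval_smul] at key2
  rw [inv_smul_eq_iff₀ hg, smul_comm, eq_inv_smul_iff₀ hh]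
  exact key2

open Classical in
/-- The value of a rational function at a point where it is regular (and `0` elsewhere). -/
def valueAt (F : RatField σ ⊗[ℂ] A) (p : σ → ℂ) : A :=
  if h : ∃ v, HasValueAt F p v then h.choose else 0

theorem valueAt_eq {F : RatField σ ⊗[ℂ] A} {p : σ → ℂ} {v : A} (h : HasValueAt F p v) :
    valueAt F p = v := by
  have h' : ∃ v, HasValueAt F p v := ⟨v, h⟩
  rw [valueAt, dif_pos h']
  exact h'.choose_spec.unique h

end RationalFunctions

/-! ### The operators `P_kl` and `Q_kl` -/

/-- The space `(ℂ^N)^{⊗ n}`. -/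
abbrev TensorPower (N n : ℕ) : Type := ⨂[ℂ] (_ : Fin n), (Fin N → ℂ)

/-- The algebra of linear operators in `(ℂ^N)^{⊗ n}`. -/
abbrev Op (N n : ℕ) : Type := Module.End ℂ (TensorPower N n)

/-- The operator `P_kl` exchanging the `k`th and `l`th tensor factors. -/
def opP (N : ℕ) {n : ℕ} (k l : Fin n) : Op N n :=
  (PiTensorProduct.reindex ℂ (fun _ : Fin n => (Fin N → ℂ)) (Equiv.swap k l)).toLinearMap

/-- The operator `Q_kl = ∑_{a,b} E_ab^{(k)} E_ab^{(l)}`, where `E_ab` are the matrix units acting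
in `ℂ^N`; `opQ_tprod` below gives its action on decomposable tensors. -/
def opQ (N : ℕ) {n : ℕ} (k l : Fin n) : Op N n :=
  ∑ a : Fin N, ∑ b : Fin N, PiTensorProduct.map fun m : Fin n =>
    if m = k ∨ m = l then Matrix.toLin' (Matrix.single a b (1 : ℂ)) else LinearMap.id

theorem opP_tprod (N : ℕ) {n : ℕ} (k l : Fin n) (v : Fin n → Fin N → ℂ) :
    opP N k l (PiTensorProduct.tprod ℂ v) =
      PiTensorProduct.tprod ℂ fun m => v (Equiv.swap k l m) := by
  simp [opP, PiTensorProduct.reindex_tprod]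

/-- In the `k`th and `l`th factors `Q_kl` acts as `u ⊗ v ↦ ⟨u, v⟩ ∑_a e_a ⊗ e_a`,
and it acts as the identity in the other factors. -/
theorem opQ_tprod (N : ℕ) {n : ℕ} {k l : Fin n} (hkl : k ≠ l) (v : Fin n → Fin N → ℂ) :
    opQ N k l (PiTensorProduct.tprod ℂ v) =
      (v k ⬝ᵥ v l) • ∑ a : Fin N, PiTensorProduct.tprod ℂ
        (Function.update (Function.update v k (Pi.single a 1)) l (Pi.single a 1)) := by
  have h : ∀ a b : Fin N,
      (fun m : Fin n => (if m = k ∨ m = l then Matrix.toLin' (Matrix.single a b (1 : ℂ))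
        else LinearMap.id) (v m)) =
      Function.update (Function.update v k (v k b • Pi.single a (1 : ℂ))) l
        (v l b • Pi.single a (1 : ℂ)) := by
    intro a b
    have hs : ∀ w : Fin N → ℂ,
        Matrix.toLin' (Matrix.single a b (1 : ℂ)) w = w b • Pi.single a (1 : ℂ) := by
      intro w
      ext c
      simp [Matrix.single_mulVec, Pi.single_apply, Function.update_apply]
    funext m
    by_cases hl : m = l
    · subst hl; simp only [or_true, if_true, hs, Function.update_self]
    · by_cases hk : m = k
      · subst hk
        simp only [true_or, if_true, hs, Function.update_of_ne hl, Function.update_self]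
      · simp [hl, hk]
  simp only [opQ, LinearMap.sum_apply, PiTensorProduct.map_tprod, h, MultilinearMap.map_update_smul]
  have h2 : ∀ a b : Fin N, PiTensorProduct.tprod ℂ
      (Function.update (Function.update v k (v k b • Pi.single a (1 : ℂ))) l
        (Pi.single a (1 : ℂ))) = v k b • PiTensorProduct.tprod ℂ
      (Function.update (Function.update v k (Pi.single a (1 : ℂ))) l (Pi.single a (1 : ℂ))) := by
    intro a b
    rw [Function.update_comm hkl, MultilinearMap.map_update_smul, Function.update_comm hkl]
  simp only [h2, smul_smul, ← Finset.sum_smul, ← Finset.smul_sum, dotProduct, mul_comm]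

/-- The Brauer centralizer algebra: the algebra of operators in `(ℂ^N)^{⊗ n}` generated by all
`P_kl` and `Q_kl` with `k < l`. -/
def brauerAlgebra (N n : ℕ) : Subalgebra ℂ (Op N n) :=
  Algebra.adjoin ℂ {T | ∃ k l : Fin n, k < l ∧ (T = opP N k l ∨ T = opQ N k l)}

/-! ### The column tableau of a skew Young diagram -/

section Tableau

variable (lam mu : YoungDiagram)

/-- The boxes of the skew Young diagram `ω` of `λ` and `μ`, the box `(i, j)` in row `i` and
column `j` being recorded as `(j, i)`, in the lexicographic order. Thus boxes are
ordered by columns from left to right, downwards in every column.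
Rows and columns are numbered from `0`. -/
def boxes : Finset (ℕ ×ₗ ℕ) :=
  (lam.cells \ mu.cells).image fun b => toLex (b.2, b.1)

/-- The number `n` of boxes of `ω`. -/
def size : ℕ := (boxes lam mu).card

/-- The box filled with the number `k` in the column tableau `Ω`, as a pair (column, row).
The numbers start from `0`. -/
def box (k : Fin (size lam mu)) : ℕ × ℕ :=
  ofLex ((boxes lam mu).orderEmbOfFin rfl k)

/-- The content `c_k`: column minus row of the box filled with `k`. -/
def content (k : Fin (size lam mu)) : ℤ :=
  ((box lam mu k).1 : ℤ) - ((box lam mu k).2 : ℤ)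

/-- The type of non-empty columns of `ω`; it indexes the independent variables. -/
abbrev Column : Type := {j : ℕ // ∃ k, (box lam mu k).1 = j}

/-- The column of `Ω` that contains the number `k`. -/
def column (k : Fin (size lam mu)) : Column lam mu := ⟨(box lam mu k).1, k, rfl⟩

/-- The variable `t_k`; by construction `t_k = t_l` if `k` and `l` are in the same column. -/
def tvar (k : Fin (size lam mu)) : RatField (Column lam mu) :=
  ratVar (column lam mu k)

/-- All pairs `(k, l)` with `k < l`, in the lexicographic order. -/
def pairs (n : ℕ) : List (Fin n × Fin n) :=
  ((List.finRange n).product (List.finRange n)).filter fun q => q.1 < q.2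

/-- The pairs `(k, l)` with `k < l` such that `k` and `l` are in different columns of `Ω`,
in the lexicographic order. -/
def columnPairs : List (Fin (size lam mu) × Fin (size lam mu)) :=
  (pairs (size lam mu)).filter fun q => column lam mu q.1 ≠ column lam mu q.2

/-! ### The ordered products -/

/-- The ordered product of the factors `1 - P_kl / (c_k - c_l + t_k - t_l)` over `k < l`. -/
def fusionP (N : ℕ) : RatField (Column lam mu) ⊗[ℂ] Op N (size lam mu) :=
  ((pairs (size lam mu)).map fun q =>
    1 - ((content lam mu q.1 : RatField (Column lam mu)) - (content lam mu q.2 : RatField _)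
      + tvar lam mu q.1 - tvar lam mu q.2)⁻¹ ⊗ₜ[ℂ] opP N q.1 q.2).prod

/-- The ordered product of the factors `1 - Q_kl / (c_k + c_l + t_k + t_l + N + M)`
over `k < l`. -/
def fusionQ (N M : ℕ) : RatField (Column lam mu) ⊗[ℂ] Op N (size lam mu) :=
  ((pairs (size lam mu)).map fun q =>
    1 - ((content lam mu q.1 : RatField (Column lam mu)) + (content lam mu q.2 : RatField _)
      + tvar lam mu q.1 + tvar lam mu q.2 + (N : RatField _) + (M : RatField _))⁻¹
      ⊗ₜ[ℂ] opQ N q.1 q.2).prod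

/-- The operator `E_Ω`: the value of `fusionP` at `t_1 = … = t_n` (taken at `0`). -/
def opE (N : ℕ) : Op N (size lam mu) := valueAt (fusionP lam mu N) fun _ => 0

/-- The factor `1 - Q_kl / (c_k + c_l + N + M - 1)`. -/
def factorQ (N M : ℕ) (q : Fin (size lam mu) × Fin (size lam mu)) : Op N (size lam mu) :=
  1 - ((content lam mu q.1 : ℂ) + (content lam mu q.2 : ℂ) + (N : ℂ) + (M : ℂ) - 1)⁻¹
    • opQ N q.1 q.2

/-- The operator `F_Ω(M)`. -/
def opF (N M : ℕ) : Op N (size lam mu) :=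
  ((columnPairs lam mu).map (factorQ lam mu N M)).prod * opE lam mu N

end Tableau

end BrauerFusion

end

/-! The proof works over the field of rational functions, with the spectral parameters `s k = c_k +
t_k`. The operators `P` and `Q` satisfy the relations of `BrauerRelations`; the relation `Q² = N Q`
is not among them, so `N` enters only through the shift `N + M`. These relations make the factors of
`R` and `K` a solution of the Yang–Baxter equations, and the rows of `K` can be carried through `R`:
`K R = R K'`, where `K'` is the product `K` in reverse order (`YangBaxter.tri_mul_tri`).

Singularities are removed by skew-symmetry. Along a column the parameters drop by 1, so the factors
of `R` inside a column make `R` skew-symmetric in that column. On a skew-symmetric element the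
product of the factors of one row over a column telescopes to a single fraction: for `P` the only
remaining pole is at the top box of the column (`row_rFactor_mul`), for `Q` at the bottom box
(`row_kFactor_mul`). In a skew diagram the content of a box never equals the content of the top box
of a later column, so the resulting expression `columnProduct` for `R` is regular on the diagonal;
it depends only on differences of the parameters, hence is constant there.

The factors of `K` inside a column act as the identity on skew-symmetric elements, since `Q P = Q`
forces `Q X = 0` when `P X = -X`. They can therefore be dropped, because the factors between
different columns preserve skew-symmetry (`tri_kFactor_mul`). Applying the same argument in the
opposite algebra drops them from `R K'` as well. The remaining denominators at `t = -1/2` are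
positive by the bound on the first two columns, and evaluating the two expressions of one rational
function gives both forms of the operator. -/

namespace BrauerFusion

/-! ### Brauer relations and the Yang–Baxter equations. -/

section Abstract

variable {ι B : Type*} [Ring B]

/-- The relations between the transpositions and the contractions in the Brauer algebra. -/
structure BrauerRelations (p q : ι → ι → B) : Prop where
  p_symm : ∀ a b, p a b = p b a
  q_symm : ∀ a b, q a b = q b a
  p_sq : ∀ ⦃a b⦄, a ≠ b → p a b * p a b = 1
  p_comm : ∀ ⦃a b c d⦄, [a, b, c, d].Nodup → Commute (p a b) (p c d)
  pq_comm : ∀ ⦃a b c d⦄, [a, b, c, d].Nodup → Commute (p a b) (q c d)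
  q_comm : ∀ ⦃a b c d⦄, [a, b, c, d].Nodup → Commute (q a b) (q c d)
  p_braid : ∀ ⦃a b c⦄, [a, b, c].Nodup → p a b * p a c = p a c * p b c
  p_mul_q : ∀ ⦃a b⦄, a ≠ b → p a b * q a b = q a b
  q_mul_p : ∀ ⦃a b⦄, a ≠ b → q a b * p a b = q a b
  p_conj_q : ∀ ⦃a b c⦄, [a, b, c].Nodup → p a b * q a c = q b c * p a b
  q_mul_q : ∀ ⦃a b c⦄, [a, b, c].Nodup → q a c * q b c = q a c * p a b

theorem BrauerRelations.map {p q : ι → ι → B} (h : BrauerRelations p q) {B' : Type*} [Ring B']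
    (φ : B →+* B') : BrauerRelations (fun a b => φ (p a b)) (fun a b => φ (q a b)) where
  p_symm a b := by rw [h.p_symm]
  q_symm a b := by rw [h.q_symm]
  p_sq a b hab := by rw [← map_mul, h.p_sq hab, map_one]
  p_comm a b c d hd := (h.p_comm hd).map φ
  pq_comm a b c d hd := (h.pq_comm hd).map φ
  q_comm a b c d hd := (h.q_comm hd).map φ
  p_braid a b c hd := by simp only [← map_mul, h.p_braid hd]
  p_mul_q a b hd := by simp only [← map_mul, h.p_mul_q hd]
  q_mul_p a b hd := by simp only [← map_mul, h.q_mul_p hd]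
  p_conj_q a b c hd := by simp only [← map_mul, h.p_conj_q hd]
  q_mul_q a b c hd := by simp only [← map_mul, h.q_mul_q hd]

theorem nodup_rotate {a b c : ι} (h : [a, b, c].Nodup) : [c, a, b].Nodup := by
  simp at h ⊢; tauto

theorem nodup_swap {a b c : ι} (h : [a, b, c].Nodup) : [b, a, c].Nodup := by
  simp at h ⊢; tauto

/-- The relations are symmetric under reversal of products, so every statement about left
multiplication yields its right-handed version. -/
theorem BrauerRelations.op {p q : ι → ι → B} (h : BrauerRelations p q) :
    BrauerRelations (fun a b => MulOpposite.op (p a b)) (fun a b => MulOpposite.op (q a b)) where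
  p_symm a b := by rw [h.p_symm]
  q_symm a b := by rw [h.q_symm]
  p_sq a b hab := by rw [← MulOpposite.op_mul, h.p_sq hab, MulOpposite.op_one]
  p_comm a b c d hd := (h.p_comm hd).op
  pq_comm a b c d hd := (h.pq_comm hd).op
  q_comm a b c d hd := (h.q_comm hd).op
  p_braid a b c hd := by
    have h1 := h.p_braid (nodup_rotate (nodup_rotate (nodup_swap hd)))
    have h2 := h.p_braid (nodup_swap hd)
    rw [h.p_symm c b] at h1
    rw [h.p_symm b a] at h2
    rw [← MulOpposite.op_mul, ← MulOpposite.op_mul, h1, h2]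
  p_mul_q a b hd := by simp only [← MulOpposite.op_mul, h.q_mul_p hd]
  q_mul_p a b hd := by simp only [← MulOpposite.op_mul, h.p_mul_q hd]
  p_conj_q a b c hd := by
    simp only [← MulOpposite.op_mul]
    rw [h.p_symm a b, h.p_conj_q (nodup_swap hd)]
  q_mul_q a b c hd := by
    simp only [← MulOpposite.op_mul]
    rw [h.q_mul_q (nodup_swap hd), h.p_symm b a, h.p_conj_q hd]

/-- The ordered product of `f a b` over all pairs of entries of a list, `a` preceding `b`,
in the lexicographic order. -/
def tri (f : ι → ι → B) : List ι → B
  | [] => 1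
  | a :: L => (L.map (f a)).prod * tri f L

/-- The ordered product of `f a b` over all pairs of entries of a list, `a` preceding `b`,
in the order reverse to the lexicographic one. -/
def triRev (f : ι → ι → B) : List ι → B
  | [] => 1
  | a :: L => triRev f L * (L.reverse.map (f a)).prod

theorem tri_op (f : ι → ι → B) (L : List ι) :
    tri (fun a b => MulOpposite.op (f a b)) L = MulOpposite.op (triRev f L) := by
  induction L with
  | nil => rfl
  | cons a L ih =>
    simp only [tri, triRev, MulOpposite.op_mul, ih, MulOpposite.op_list_prod]
    simp [List.map_map, Function.comp_def]

theorem commute_list_prod {x : B} {f : ι → B} {L : List ι} (h : ∀ l ∈ L, Commute x (f l)) :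
    Commute x (L.map f).prod :=
  Commute.list_prod_right _ _ (by simpa using h)

theorem commute_tri {x : B} {f : ι → ι → B} {L : List ι} (hL : L.Nodup)
    (h : ∀ k ∈ L, ∀ l ∈ L, k ≠ l → Commute x (f k l)) : Commute x (tri f L) := by
  induction L with
  | nil => exact Commute.one_right x
  | cons a L ih =>
    rw [List.nodup_cons] at hL
    refine Commute.mul_right (commute_list_prod fun l hl => h a (by simp) l (by simp [hl]) ?_)
      (ih hL.2 fun k hk l hl => h k (by simp [hk]) l (by simp [hl]))
    rintro rfl; exact hL.1 hl

theorem commute_triRev {x : B} {f : ι → ι → B} {L : List ι} (hL : L.Nodup)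
    (h : ∀ k ∈ L, ∀ l ∈ L, k ≠ l → Commute x (f k l)) : Commute x (triRev f L) := by
  rw [← MulOpposite.unop_op x, ← MulOpposite.unop_op (triRev f L), ← tri_op]
  exact (commute_tri hL fun k hk l hl hkl => (h k hk l hl hkl).op).unop

/-- Passing `x` through a product of pairs of factors. -/
theorem prod_exchange {x : B} {f g : ι → B} {S : List ι} (hS : S.Nodup)
    (h : ∀ l ∈ S, x * f l * g l = g l * f l * x)
    (hc : ∀ l ∈ S, ∀ l' ∈ S, l ≠ l' → Commute (f l) (g l')) :
    x * (S.map f).prod * (S.map g).prod = (S.map g).prod * (S.map f).prod * x := by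
  induction S with
  | nil => simp
  | cons a S ih =>
    rw [List.nodup_cons] at hS
    have ne : ∀ l ∈ S, l ≠ a := by rintro l hl rfl; exact hS.1 hl
    have ih := ih hS.2 (fun l hl => h l (by simp [hl]))
      fun l hl l' hl' => hc l (by simp [hl]) l' (by simp [hl'])
    have h1 : Commute (S.map f).prod (g a) :=
      (commute_list_prod fun l hl => (hc l (by simp [hl]) a (by simp) (ne l hl)).symm).symm
    have h2 : Commute (f a) (S.map g).prod :=
      commute_list_prod fun l hl => hc a (by simp) l (by simp [hl]) (ne l hl).symm
    simp only [List.map_cons, List.prod_cons]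
    calc x * (f a * (S.map f).prod) * (g a * (S.map g).prod)
        = x * f a * ((S.map f).prod * g a) * (S.map g).prod := by noncomm_ring
      _ = (x * f a * g a) * (S.map f).prod * (S.map g).prod := by rw [h1.eq]; noncomm_ring
      _ = g a * f a * (x * (S.map f).prod * (S.map g).prod) := by
        rw [h a (by simp)]; noncomm_ring
      _ = g a * (f a * (S.map g).prod) * (S.map f).prod * x := by rw [ih]; noncomm_ring
      _ = _ := by rw [h2.eq]; noncomm_ring

/-- Induction on the list: by `prod_exchange` the factor `f b` is carried past the other `f`'s and
the row `r b`, after which it commutes with the rest of the triangle. This covers both `f = r a` and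
`f = k a`. -/
theorem row_mul_tri {f : ι → B} {r : ι → ι → B} {S : List ι} (hS : S.Nodup)
    (hy : ∀ a ∈ S, ∀ b ∈ S, a ≠ b → f a * f b * r a b = r a b * f b * f a)
    (hc : ∀ ⦃a b c⦄, a ∈ S → b ∈ S → c ∈ S → [a, b, c].Nodup → Commute (f a) (r b c)) :
    (S.map f).prod * tri r S = tri r S * (S.reverse.map f).prod := by
  induction S with
  | nil => simp [tri]
  | cons b S ih =>
    rw [List.nodup_cons] at hS
    have ne : ∀ l ∈ S, b ≠ l := by rintro l hl rfl; exact hS.1 hl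
    have ih := ih hS.2 (fun a ha c hc => hy a (by simp [ha]) c (by simp [hc]))
      fun a b c h1 h2 h3 => hc (by simp [h1]) (by simp [h2]) (by simp [h3])
    have h1 := prod_exchange (x := f b) (f := f) (g := r b) hS.2
      (fun l hl => hy b (by simp) l (by simp [hl]) (ne l hl))
      (fun l hl l' hl' hll => hc (by simp [hl]) (by simp) (by simp [hl'])
        (by simp [(ne l hl).symm, hll, ne l' hl']))
    have h2 : Commute (f b) (tri r S) := commute_tri hS.2 fun k hk l hl hkl =>
      hc (by simp) (by simp [hk]) (by simp [hl]) (by simp [hkl, ne k hk, ne l hl])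
    simp only [tri, List.map_cons, List.prod_cons, List.reverse_cons, List.map_append,
      List.prod_append, List.map_nil, List.prod_nil, mul_one]
    rw [← mul_assoc, h1, mul_assoc _ (f b), h2.eq, ← mul_assoc, mul_assoc _ _ (tri r S), ih]
    noncomm_ring

/-- The Yang–Baxter equations for the pair of families `r`, `k`. -/
structure YangBaxter (r k : ι → ι → B) : Prop where
  rr : ∀ ⦃a b c⦄, [a, b, c].Nodup → r a b * r a c * r b c = r b c * r a c * r a b
  kr : ∀ ⦃a b c⦄, [a, b, c].Nodup → k a c * k b c * r a b = r a b * k b c * k a c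
  comm_same : ∀ ⦃a b⦄, a ≠ b → Commute (k a b) (r a b)
  k_symm : ∀ a b, k a b = k b a
  r_comm : ∀ ⦃a b c d⦄, [a, b, c, d].Nodup → Commute (r a b) (r c d)
  rk_comm : ∀ ⦃a b c d⦄, [a, b, c, d].Nodup → Commute (r a b) (k c d)
  k_comm : ∀ ⦃a b c d⦄, [a, b, c, d].Nodup → Commute (k a b) (k c d)

theorem YangBaxter.row_r {r k : ι → ι → B} (h : YangBaxter r k) {a : ι} {S : List ι}
    (hS : (a :: S).Nodup) :
    (S.map (r a)).prod * tri r S = tri r S * (S.reverse.map (r a)).prod := by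
  rw [List.nodup_cons] at hS
  have ne : ∀ l ∈ S, a ≠ l := by rintro l hl rfl; exact hS.1 hl
  refine row_mul_tri hS.2 (fun b hb c hc hbc => h.rr ?_) fun b c d hb hc hd hn => h.r_comm ?_
  · simp [ne b hb, ne c hc, hbc]
  · simp at hn; simp [ne b hb, ne c hc, ne d hd, hn]

theorem YangBaxter.row_k {r k : ι → ι → B} (h : YangBaxter r k) {a : ι} {S : List ι}
    (hS : (a :: S).Nodup) :
    (S.map (k a)).prod * tri r S = tri r S * (S.reverse.map (k a)).prod := by
  rw [List.nodup_cons] at hS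
  have ne : ∀ l ∈ S, a ≠ l := by rintro l hl rfl; exact hS.1 hl
  refine row_mul_tri hS.2 (fun b hb c hc hbc => ?_)
    fun b c d hb hc hd hn => (h.rk_comm ?_).symm
  · rw [h.k_symm a b, h.k_symm a c]
    exact h.kr (by simp [(ne b hb).symm, (ne c hc).symm, hbc])
  · simp at hn
    simp [(ne c hc).symm, (ne d hd).symm, ne b hb, hn, Ne.symm (a := b) (b := c),
      Ne.symm (a := b) (b := d)]

theorem YangBaxter.tri_eq_triRev {r k : ι → ι → B} (h : YangBaxter r k) {L : List ι}
    (hL : L.Nodup) : tri r L = triRev r L := by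
  induction L with
  | nil => rfl
  | cons a L ih => rw [tri, triRev, h.row_r hL, ih (List.nodup_cons.1 hL).2]

/-- A form of the reflection equation, with `triRev k S` as the reflecting operator. In the
induction step the hypothesis for the shorter list stands between two exchanges based on `kr`,
joined by the commutation of `k a b` with `r a b`. -/
theorem YangBaxter.reflection {r k : ι → ι → B} (h : YangBaxter r k) {a : ι} {S : List ι}
    (hS : (a :: S).Nodup) :
    (S.reverse.map (k a)).prod * triRev k S * (S.reverse.map (r a)).prod =
      (S.reverse.map (r a)).prod * triRev k S * (S.reverse.map (k a)).prod := by
  induction S with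
  | nil => simp [triRev]
  | cons b S ih =>
    have hab : a ≠ b := by rintro rfl; simp at hS
    have ha : (a :: S).Nodup := by simp at hS ⊢; tauto
    have hb : (b :: S).Nodup := by simp at hS ⊢; tauto
    have hSn : S.Nodup := (List.nodup_cons.1 ha).2
    have na : ∀ l ∈ S, a ≠ l := by rintro l hl rfl; exact (List.nodup_cons.1 ha).1 hl
    have nb : ∀ l ∈ S, b ≠ l := by rintro l hl rfl; exact (List.nodup_cons.1 hb).1 hl
    have ih := ih ha
    have e1 := prod_exchange (x := k a b) (f := k b) (g := r a) (List.nodup_reverse.2 hSn)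
      (fun l hl => by
        rw [List.mem_reverse] at hl
        rw [h.k_symm b l]
        exact h.kr (by simp [na l hl, hab, (nb l hl).symm]))
      (fun l hl l' hl' hll => by
        rw [List.mem_reverse] at hl hl'
        exact (h.rk_comm (by simp [na l hl, na l' hl', nb l hl, (nb l' hl').symm, hab, hll.symm])).symm)
    have e2 := prod_exchange (x := r a b) (f := k b) (g := k a) (List.nodup_reverse.2 hSn)
      (fun l hl => by
        rw [List.mem_reverse] at hl
        exact (h.kr (by simp [na l hl, hab, nb l hl])).symm)
      (fun l hl l' hl' hll => by
        rw [List.mem_reverse] at hl hl'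
        exact h.k_comm (by simp [(na l hl).symm, na l' hl', nb l hl, nb l' hl', hab.symm, hll]))
    have c1 : Commute (k a b) (triRev k S) := commute_triRev hSn fun c hc d hd hcd =>
      h.k_comm (by simp [na c hc, na d hd, nb c hc, nb d hd, hab, hcd])
    have c2 : Commute (r a b) (triRev k S) := commute_triRev hSn fun c hc d hd hcd =>
      h.rk_comm (by simp [na c hc, na d hd, nb c hc, nb d hd, hab, hcd])
    simp only [triRev, List.map_cons, List.prod_cons, List.reverse_cons, List.map_append,
      List.prod_append, List.map_nil, List.prod_nil, mul_one]
    set Ka := (S.reverse.map (k a)).prod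
    set Kb := (S.reverse.map (k b)).prod
    set Ra := (S.reverse.map (r a)).prod
    set T := triRev k S
    calc Ka * k a b * (T * Kb) * (Ra * r a b)
        = Ka * (k a b * T) * Kb * Ra * r a b := by noncomm_ring
      _ = Ka * T * (k a b * Kb * Ra) * r a b := by rw [c1.eq]; noncomm_ring
      _ = (Ka * T * Ra) * Kb * (k a b * r a b) := by rw [e1]; noncomm_ring
      _ = Ra * T * (Ka * Kb * r a b) * k a b := by
        rw [ih, (h.comm_same hab).eq]; noncomm_ring
      _ = Ra * (T * r a b) * Kb * Ka * k a b := by rw [← e2]; noncomm_ring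
      _ = Ra * r a b * (T * Kb) * (Ka * k a b) := by rw [← c2.eq]; noncomm_ring

/-- Induction on the list: `row_k` carries the first row of `k` through the triangle of `r`,
reversing it, and `reflection` then interchanges it with the first row of `r`. -/
theorem YangBaxter.tri_mul_tri {r k : ι → ι → B} (h : YangBaxter r k) {L : List ι}
    (hL : L.Nodup) : tri k L * tri r L = tri r L * triRev k L := by
  induction L with
  | nil => simp [tri, triRev]
  | cons a S ih =>
    have hS := (List.nodup_cons.1 hL).2
    have ih := ih hS
    rw [tri, tri, triRev, h.row_r hL]
    calc (S.map (k a)).prod * tri k S * (tri r S * (S.reverse.map (r a)).prod)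
        = (S.map (k a)).prod * (tri k S * tri r S) * (S.reverse.map (r a)).prod := by noncomm_ring
      _ = ((S.map (k a)).prod * tri r S) * triRev k S * (S.reverse.map (r a)).prod := by
        rw [ih]; noncomm_ring
      _ = tri r S * ((S.reverse.map (k a)).prod * triRev k S * (S.reverse.map (r a)).prod) := by
        rw [h.row_k hL]; noncomm_ring
      _ = _ := by rw [h.reflection hL]; noncomm_ring

variable {F : Type*} [Field F] [Algebra F B]

/-- The factor `1 - p_ab / (s_a - s_b)`. -/
def rFactor (s : ι → F) (p : ι → ι → B) (a b : ι) : B := 1 - (s a - s b)⁻¹ • p a b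

/-- The factor `1 - q_ab / (s_a + s_b + m)`. -/
def kFactor (s : ι → F) (m : F) (q : ι → ι → B) (a b : ι) : B := 1 - (s a + s b + m)⁻¹ • q a b

theorem commute_one_sub_smul {x y : B} (h : Commute x y) (c : F) : Commute x (1 - c • y) :=
  (Commute.one_right x).sub_right (h.smul_right c)

theorem prod_three_factors (x y z : B) (α β γ : F) :
    (1 - α • x) * (1 - β • y) * (1 - γ • z) = 1 - α • x - β • y - γ • z + (α * β) • (x * y) +
      (α * γ) • (x * z) + (β * γ) • (y * z) - (α * β * γ) • (x * y * z) := by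
  simp only [mul_sub, sub_mul, smul_mul_assoc, mul_smul_comm, one_mul, mul_one, smul_smul, smul_sub]
  module

/-- After expansion, the triple products on both sides reduce to the same element, `p a c` or `q a
c`, and the relations identify the double products. Comparing coefficients leaves partial-fraction
identities in the parameters. -/
theorem BrauerRelations.yangBaxter {p q : ι → ι → B} (h : BrauerRelations p q) {s : ι → F} {m : F}
    (hs : ∀ a b, a ≠ b → s a ≠ s b) (hm : ∀ a b, s a + s b + m ≠ 0) :
    YangBaxter (rFactor s p) (kFactor s m q) where
  rr a b c hn := by
    have h1 := h.p_braid hn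
    have h2 := h.p_braid (nodup_rotate hn)
    have h3 := h.p_braid (nodup_rotate (nodup_rotate (nodup_swap hn)))
    have h4 := h.p_braid (nodup_swap hn)
    rw [h.p_symm c a, h.p_symm c b] at h2
    rw [h.p_symm c b] at h3
    rw [h.p_symm b a] at h4
    simp only [List.nodup_cons, List.mem_cons, not_or] at hn
    have h5 : p a b * p a c * p b c = p a c := by
      rw [h1, mul_assoc, h.p_sq (by tauto), mul_one]
    have h6 : p b c * p a c * p a b = p a c := by
      rw [← h4, ← h3, mul_assoc, h.p_sq (by tauto), mul_one]
    rw [rFactor, rFactor, rFactor, prod_three_factors, prod_three_factors, h5, h6, h1, h2, h3, h4]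
    have x : s a - s b ≠ 0 := sub_ne_zero.2 (hs _ _ (by tauto))
    have y : s a - s c ≠ 0 := sub_ne_zero.2 (hs _ _ (by tauto))
    have z : s b - s c ≠ 0 := sub_ne_zero.2 (hs _ _ (by tauto))
    match_scalars <;> field_simp <;> ring
  kr a b c hn := by
    have h1 := h.q_mul_q hn
    have h2 := h.q_mul_q (nodup_swap hn)
    have h3 := h.p_conj_q hn
    have h4 := h.p_conj_q (nodup_swap hn)
    rw [h.p_symm b a] at h2 h4
    simp only [List.nodup_cons, List.mem_cons, not_or] at hn
    have h5 : q a c * q b c * p a b = q a c := by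
      rw [h1, mul_assoc, h.p_sq (by tauto), mul_one]
    have h6 : p a b * q b c * q a c = q a c := by
      rw [mul_assoc, h2, ← mul_assoc, h4, mul_assoc, h.p_sq (by tauto), mul_one]
    rw [rFactor, kFactor, kFactor, prod_three_factors, prod_three_factors, h5, h6, h1, h2, h3, h4]
    have x : s a - s b ≠ 0 := sub_ne_zero.2 (hs _ _ (by tauto))
    have y := hm a c
    have z := hm b c
    match_scalars <;> field_simp <;> ring
  comm_same a b hab := by
    refine (commute_one_sub_smul (commute_one_sub_smul ?_ _).symm _)
    rw [Commute, SemiconjBy, h.p_mul_q hab, h.q_mul_p hab]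
  k_symm a b := by rw [kFactor, kFactor, h.q_symm a b, add_comm (s a)]
  r_comm a b c d hn := (commute_one_sub_smul (commute_one_sub_smul (h.p_comm hn) _).symm _).symm
  rk_comm a b c d hn := (commute_one_sub_smul (commute_one_sub_smul (h.pq_comm hn) _).symm _).symm
  k_comm a b c d hn := (commute_one_sub_smul (commute_one_sub_smul (h.q_comm hn) _).symm _).symm

end Abstract

/-! ### Skew-symmetry along columns and cancellation of poles. -/

section Columns

variable {ι B : Type*} [Ring B]

theorem prod_map_mul_prod_map {f g : ι → B} {L : List ι} (hL : L.Nodup)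
    (h : ∀ l ∈ L, ∀ l' ∈ L, l ≠ l' → Commute (f l) (g l')) :
    (L.map f).prod * (L.map g).prod = (L.map fun l => f l * g l).prod := by
  induction L with
  | nil => simp
  | cons a L ih =>
    rw [List.nodup_cons] at hL
    have hc : Commute (g a) (L.map f).prod := commute_list_prod fun l hl =>
      (h l (by simp [hl]) a (by simp) (by rintro rfl; exact hL.1 hl)).symm
    simp only [List.map_cons, List.prod_cons,
      ← ih hL.2 fun l hl l' hl' => h l (by simp [hl]) l' (by simp [hl'])]
    rw [mul_assoc, ← mul_assoc _ (g a), ← hc.eq]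
    noncomm_ring

/-- The ordered product of `f k l` over `k` in one list and `l` in another. -/
def rect (f : ι → ι → B) (C L : List ι) : B := (C.map fun k => (L.map (f k)).prod).prod

theorem rect_swap {f : ι → ι → B} {C L : List ι} (hC : C.Nodup) (hL : L.Nodup)
    (h : ∀ k ∈ C, ∀ k' ∈ C, ∀ l ∈ L, ∀ l' ∈ L, k ≠ k' → l ≠ l' →
      Commute (f k l) (f k' l')) :
    rect f C L = (L.map fun l => (C.map fun k => f k l).prod).prod := by
  induction C with
  | nil => simp [rect]
  | cons a C ih =>
    rw [List.nodup_cons] at hC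
    have ih := ih hC.2 fun k hk k' hk' => h k (by simp [hk]) k' (by simp [hk'])
    rw [rect] at ih ⊢
    simp only [List.map_cons, List.prod_cons]
    rw [ih]
    exact prod_map_mul_prod_map hL fun l hl l' hl' hll => commute_list_prod fun k hk =>
      h a (by simp) k (by simp [hk]) l hl l' hl' (by rintro rfl; exact hC.1 hk) hll

theorem tri_append {f : ι → ι → B}
    (hf : ∀ ⦃a b c d⦄, [a, b, c, d].Nodup → Commute (f a b) (f c d)) {C L : List ι}
    (hCL : (C ++ L).Nodup) : tri f (C ++ L) = tri f C * rect f C L * tri f L := by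
  induction C with
  | nil => simp [tri, rect]
  | cons a C ih =>
    rw [List.cons_append, List.nodup_cons] at hCL
    have hC : C.Nodup := (List.nodup_append.1 hCL.2).1
    have ne : ∀ k ∈ C, a ≠ k := by rintro k hk rfl; simp [hk] at hCL
    have ne' : ∀ k ∈ L, a ≠ k := by rintro k hk rfl; simp [hk] at hCL
    have ne2 := (List.nodup_append.1 hCL.2).2.2
    have hc : Commute (L.map (f a)).prod (tri f C) := commute_tri hC fun k hk l hl hkl =>
      (commute_list_prod fun m hm => hf (by
        simp [hkl, ne2 k hk m hm, ne2 l hl m hm, (ne k hk).symm, (ne l hl).symm, ne' m hm])).symm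
    simp only [List.cons_append, tri, rect, List.map_append, List.prod_append, List.map_cons,
      List.prod_cons, ih hCL.2]
    calc (C.map (f a)).prod * (L.map (f a)).prod * (tri f C * rect f C L * tri f L)
        = (C.map (f a)).prod * ((L.map (f a)).prod * tri f C) * rect f C L * tri f L := by
          noncomm_ring
      _ = _ := by rw [hc.eq, rect]; noncomm_ring

/-- Replaces factors one at a time from the right, when they agree only on elements with a property
that survives each replacement; in most uses `P` is skew-symmetry. -/
theorem prod_mul_congr {α : Type*} {P : B → Prop} {f g : α → B} {L : List α}
    (h : ∀ x ∈ L, ∀ X, P X → f x * X = g x * X ∧ P (g x * X)) {X : B} (hX : P X) :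
    (L.map f).prod * X = (L.map g).prod * X ∧ P ((L.map g).prod * X) := by
  induction L with
  | nil => simpa using hX
  | cons a L ih =>
    have ih := ih fun x hx => h x (by simp [hx])
    have := h a (by simp) _ ih.2
    simp only [List.map_cons, List.prod_cons, mul_assoc]
    exact ⟨by rw [ih.1, this.1], this.2⟩

theorem mul_sum_mul {f g : ι → B} {L : List ι} {x X : B}
    (h : ∀ l ∈ L, x * f l * X = -(g l * X)) :
    x * (L.map f).sum * X = -((L.map g).sum * X) := by
  induction L with
  | nil => simp
  | cons a L ih =>
    simp only [List.map_cons, List.sum_cons, mul_add, add_mul, h a (by simp),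
      ih fun l hl => h l (by simp [hl])]
    abel

/-- The element `X` is skew-symmetric on the left under the transpositions in `C`. -/
def IsAlt (p : ι → ι → B) (C : List ι) (X : B) : Prop :=
  ∀ a ∈ C, ∀ b ∈ C, a ≠ b → p a b * X = -X

theorem IsAlt.mono {p : ι → ι → B} {C C' : List ι} {X : B} (h : IsAlt p C X) (hC : C' ⊆ C) :
    IsAlt p C' X := fun a ha b hb => h a (hC ha) b (hC hb)

theorem IsAlt.mul {p : ι → ι → B} {C : List ι} {X Y : B} (h : IsAlt p C X)
    (hY : ∀ a ∈ C, ∀ b ∈ C, a ≠ b → Commute (p a b) Y) : IsAlt p C (Y * X) := fun a ha b hb hab => by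
  rw [← mul_assoc, (hY a ha b hb hab).eq, mul_assoc, h a ha b hb hab, mul_neg]

theorem BrauerRelations.p_conj_p {p q : ι → ι → B} (h : BrauerRelations p q) {a b c : ι}
    (hn : [a, b, c].Nodup) : p a b * p a c = p b c * p a b := by
  have h2 := h.p_braid (nodup_rotate hn)
  rw [h.p_symm c a, h.p_symm c b] at h2
  rw [h.p_braid hn, h2]

open Classical in
-- Moving `x` across the sum permutes the summands by the transposition of `a` and `b`, which
-- preserves `L` because `a` and `b` are both in it or both outside it.
theorem commute_sum_of_conj {p : ι → B} {x : B} {a b : ι} {L : List ι} (hL : L.Nodup)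
    (hab : a ∈ L ↔ b ∈ L) (h : ∀ l ∈ L, x * p l = p (Equiv.swap a b l) * x) :
    Commute x (L.map p).sum := by
  have hp : (L.map (Equiv.swap a b)).Perm L := by
    refine (List.perm_ext_iff_of_nodup (hL.map (Equiv.injective _)) hL).2 fun c => ?_
    rw [List.mem_map]
    constructor
    · rintro ⟨d, hd, rfl⟩
      rcases eq_or_ne d a with rfl | h1
      · simpa using hab.1 hd
      rcases eq_or_ne d b with rfl | h2
      · simpa using hab.2 hd
      rwa [Equiv.swap_apply_of_ne_of_ne h1 h2]
    · intro hc
      refine ⟨Equiv.swap a b c, ?_, by simp⟩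
      rcases eq_or_ne c a with rfl | h1
      · simpa using hab.1 hc
      rcases eq_or_ne c b with rfl | h2
      · simpa using hab.2 hc
      rwa [Equiv.swap_apply_of_ne_of_ne h1 h2]
  have h2 : x * (L.map p).sum = ((L.map (Equiv.swap a b)).map p).sum * x := by
    clear hp hab hL
    induction L with
    | nil => simp
    | cons c L ih =>
      simp only [List.map_cons, List.sum_cons, mul_add, add_mul, h c (by simp),
        ih fun l hl => h l (by simp [hl])]
  rw [Commute, SemiconjBy, h2, (hp.map p).sum_eq]

theorem BrauerRelations.commute_sum_p {p q : ι → ι → B} (h : BrauerRelations p q) {a b k : ι}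
    {L : List ι} (hL : L.Nodup) (hab : a ∈ L ↔ b ∈ L) (hne : a ≠ b) (ha : a ≠ k) (hb : b ≠ k)
    (hk : k ∉ L) : Commute (p a b) (L.map (p k)).sum := by
  classical
  refine commute_sum_of_conj hL hab fun l hl => ?_
  have hlk : l ≠ k := by rintro rfl; exact hk hl
  rcases eq_or_ne l a with rfl | h1
  · rw [Equiv.swap_apply_left, h.p_symm k, h.p_symm k]
    exact h.p_conj_p (by simp [hne, ha, hb])
  rcases eq_or_ne l b with rfl | h2
  · rw [Equiv.swap_apply_right, h.p_symm k, h.p_symm k, h.p_symm a]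
    exact h.p_conj_p (by simp [hne.symm, ha, hb])
  rw [Equiv.swap_apply_of_ne_of_ne h1 h2]
  exact h.p_comm (by simp [hne, ha, hb, h1.symm, h2.symm, hlk.symm])

theorem BrauerRelations.commute_sum_q {p q : ι → ι → B} (h : BrauerRelations p q) {a b k : ι}
    {L : List ι} (hL : L.Nodup) (hab : a ∈ L ↔ b ∈ L) (hne : a ≠ b) (ha : a ≠ k) (hb : b ≠ k)
    (hk : k ∉ L) : Commute (p a b) (L.map (q k)).sum := by
  classical
  refine commute_sum_of_conj hL hab fun l hl => ?_
  have hlk : l ≠ k := by rintro rfl; exact hk hl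
  rcases eq_or_ne l a with rfl | h1
  · rw [Equiv.swap_apply_left, h.q_symm k, h.q_symm k]
    exact h.p_conj_q (by simp [hne, ha, hb])
  rcases eq_or_ne l b with rfl | h2
  · rw [Equiv.swap_apply_right, h.q_symm k, h.q_symm k, h.p_symm a]
    exact h.p_conj_q (by simp [hne.symm, ha, hb])
  rw [Equiv.swap_apply_of_ne_of_ne h1 h2]
  exact h.pq_comm (by simp [hne, ha, hb, h1.symm, h2.symm, hlk.symm])

variable {F : Type*} [Field F] [Algebra F B]

theorem one_sub_smul_mul_one_sub_smul (x y X : B) (α β : F) :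
    (1 - α • x) * ((1 - β • y) * X) =
      X - α • (x * X) - β • (y * X) + (α * β) • (x * y * X) := by
  simp only [mul_sub, sub_mul, smul_mul_assoc, mul_smul_comm, one_mul, smul_smul, smul_sub,
    mul_assoc]
  module

/-- The product of the factors `1 - p_kl / (s_k - s_l)` over `l` in a column,
as it acts on elements skew-symmetric in that column. -/
def topFactor (s : ι → F) (p : ι → ι → B) (k : ι) : List ι → B
  | [] => 1
  | a :: C => 1 - (s k - s a)⁻¹ • ((a :: C).map (p k)).sum

/-- Telescoping: the braid relation and skew-symmetry give `p k a * p k l * X = -(p k l * X)`. Since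
`s b = s a - 1` for the next entry `b`, the coefficient of the tail sum changes from `(s k - s b)⁻¹`
to `(s k - s a)⁻¹`, so only the top entry's pole survives. -/
theorem BrauerRelations.row_rFactor_mul {p q : ι → ι → B} (h : BrauerRelations p q) {s : ι → F}
    {k : ι} {C : List ι} {X : B} (hX : IsAlt p C X) (hk : (k :: C).Nodup)
    (hC : C.IsChain fun a b => s a - s b = 1) (hs : ∀ l ∈ C, s k - s l ≠ 0) :
    (C.map (rFactor s p k)).prod * X = topFactor s p k C * X := by
  induction C with
  | nil => simp [topFactor]
  | cons a C ih =>
    have hk' : (k :: C).Nodup := by simp at hk ⊢; tauto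
    have ih := ih (hX.mono (by simp)) hk' hC.of_cons fun l hl => hs l (by simp [hl])
    rw [List.map_cons, List.prod_cons, mul_assoc, ih]
    cases C with
    | nil => simp [topFactor, rFactor]
    | cons b C =>
      have hsb : s b = s a - 1 := by rw [List.isChain_cons_cons] at hC; linear_combination -hC.1
      have hS : p k a * ((b :: C).map (p k)).sum * X = -(((b :: C).map (p k)).sum * X) :=
        mul_sum_mul fun l hl => by
          have hn : [k, a, l].Nodup := by
            rw [List.nodup_cons, List.nodup_cons] at hk
            have h1 : k ≠ l := by rintro rfl; exact hk.1 (by simp [hl])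
            have h2 : a ≠ l := by rintro rfl; exact hk.2.1 hl
            have h3 : k ≠ a := by rintro rfl; exact hk.1 (by simp)
            simp [h1, h2, h3]
          rw [h.p_braid hn, mul_assoc, hX a (by simp) l (by simp [hl]) (by simp at hn; tauto),
            mul_neg]
      have x := hs a (by simp)
      have y := hs b (by simp)
      rw [topFactor, topFactor, rFactor]
      rw [List.map_cons (l := b :: C), List.sum_cons]
      generalize ((b :: C).map (p k)).sum = S at hS ⊢
      rw [one_sub_smul_mul_one_sub_smul, hS, sub_mul, one_mul, smul_mul_assoc, add_mul]
      rw [hsb] at y ⊢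
      match_scalars <;> field_simp <;> ring

theorem BrauerRelations.topFactor_commute {p q : ι → ι → B} (h : BrauerRelations p q) {s : ι → F}
    {a b k : ι} {C : List ι} (hC : C.Nodup) (hab : a ∈ C ↔ b ∈ C) (hne : a ≠ b)
    (ha : a ≠ k) (hb : b ≠ k) (hk : k ∉ C) : Commute (p a b) (topFactor s p k C) := by
  cases C with
  | nil => exact Commute.one_right _
  | cons c C => exact commute_one_sub_smul (h.commute_sum_p hC hab hne ha hb hk) _

theorem exists_eq_sub_length {s : ι → F} {a : ι} {C : List ι}
    (hC : (a :: C).IsChain fun a b => s a - s b = 1) :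
    ∃ z ∈ a :: C, s z = s a - C.length := by
  induction C generalizing a with
  | nil => exact ⟨a, by simp, by simp⟩
  | cons b C ih =>
    obtain ⟨z, hz, e⟩ := ih hC.of_cons
    rw [List.isChain_cons_cons] at hC
    refine ⟨z, by simp at hz ⊢; tauto, ?_⟩
    rw [e, List.length_cons, Nat.cast_succ]
    linear_combination -hC.1

/-- Here `q k a * q k l * X = -(q k a * X)`, so each entry `l` below `a` contributes a multiple of
`q k a`. Counting these entries turns its coefficient into that of the tail sum; the surviving pole
belongs to the bottom entry. -/
theorem BrauerRelations.row_kFactor_mul {p q : ι → ι → B} (h : BrauerRelations p q) {s : ι → F}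
    {m : F} {k a : ι} {C : List ι} {X : B} (hX : IsAlt p (a :: C) X) (hk : (k :: a :: C).Nodup)
    (hC : (a :: C).IsChain fun a b => s a - s b = 1) (hm : ∀ l ∈ a :: C, s k + s l + m ≠ 0) :
    ((a :: C).map (kFactor s m q k)).prod * X =
      (1 - (s k + s a + m - C.length)⁻¹ • ((a :: C).map (q k)).sum) * X := by
  induction C generalizing a with
  | nil => simp [kFactor]
  | cons b C ih =>
    have hk' : (k :: b :: C).Nodup := by simp at hk ⊢; tauto
    have ih := ih (hX.mono (by simp)) hk' hC.of_cons fun l hl => hm l (by simp at hl ⊢; tauto)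
    -- `z` is the bottom entry; its non-vanishing denominator is the common one of the resulting
    -- fraction.
    obtain ⟨z, hz, e⟩ := exists_eq_sub_length hC
    have hsb : s b = s a - 1 := by rw [List.isChain_cons_cons] at hC; linear_combination -hC.1
    have hS : q k a * ((b :: C).map (q k)).sum * X =
        -(((b :: C).map fun _ => q k a).sum * X) := mul_sum_mul fun l hl => by
      have hn : [a, l, k].Nodup := by
        rw [List.nodup_cons, List.nodup_cons] at hk
        have h1 : k ≠ l := by rintro rfl; exact hk.1 (by simp [hl])
        have h2 : a ≠ l := by rintro rfl; exact hk.2.1 hl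
        have h3 : k ≠ a := by rintro rfl; exact hk.1 (by simp)
        simp [h1.symm, h2, h3.symm]
      rw [h.q_symm k a, h.q_symm k l, h.q_mul_q hn, mul_assoc,
        hX a (by simp) l (by simp [hl]) (by simp at hn; tauto), mul_neg]
    have x := hm a (by simp)
    have y := hm z hz
    rw [List.map_cons, List.prod_cons, mul_assoc, ih, kFactor, List.map_cons (l := b :: C),
      List.sum_cons]
    rw [List.map_const', List.sum_replicate, List.length_cons] at hS
    rw [List.length_cons] at e ⊢
    generalize ((b :: C).map (q k)).sum = S at hS ⊢
    rw [one_sub_smul_mul_one_sub_smul, hS, sub_mul, one_mul, smul_mul_assoc,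
      smul_mul_assoc, add_mul]
    rw [e] at y
    push_cast at y ⊢
    have e1 : s k + s b + m - C.length = s k + s a + m - (C.length + 1) := by rw [hsb]; ring
    have y' : s k + s a + m - (C.length + 1) ≠ 0 := by intro h0; apply y; rw [← h0]; ring
    rw [e1]
    rw [← Nat.cast_smul_eq_nsmul F]
    push_cast
    match_scalars <;> field_simp <;> ring

/-- The individual factors do not preserve skew-symmetry, but the sum over all of `C` given by
`row_kFactor_mul` commutes with transpositions inside `C` or disjoint from it. -/
theorem BrauerRelations.row_kFactor_isAlt {p q : ι → ι → B} (h : BrauerRelations p q) {s : ι → F}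
    {m : F} {k : ι} {C D : List ι} {X : B} (hX : IsAlt p C X) (hk : (k :: C).Nodup)
    (hC : C.IsChain fun a b => s a - s b = 1) (hm : ∀ l ∈ C, s k + s l + m ≠ 0)
    (hD : IsAlt p D X) (hkD : k ∉ D) (hCD : D = C ∨ D.Disjoint C) :
    IsAlt p D ((C.map (kFactor s m q k)).prod * X) := by
  cases C with
  | nil => simpa using hD
  | cons c C =>
    rw [h.row_kFactor_mul hX hk hC hm]
    have hk2 := List.nodup_cons.1 hk
    refine hD.mul fun a ha b hb hab => commute_one_sub_smul
      (h.commute_sum_q hk2.2 ?_ hab ?_ ?_ hk2.1) _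
    · rcases hCD with rfl | hd
      · exact iff_of_true ha hb
      · exact iff_of_false (hd ha) (hd hb)
    · rintro rfl; exact hkD ha
    · rintro rfl; exact hkD hb

/-- A regular expression for the ordered product of the factors `1 - p_kl / (s_k - s_l)`
over the entries of a list of columns. -/
def columnProduct (s : ι → F) (p : ι → ι → B) : List (List ι) → B
  | [] => 1
  | C :: LL => tri (rFactor s p) C *
      (C.map fun k => (LL.map (topFactor s p k)).prod).prod * columnProduct s p LL

theorem rect_flatten (f : ι → ι → B) (C : List ι) (LL : List (List ι)) :
    rect f C LL.flatten =
      (C.map fun k => (LL.map fun C' => (C'.map (f k)).prod).prod).prod := by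
  simp [rect, List.map_flatten, List.prod_flatten, Function.comp_def]

theorem eq_or_disjoint {LL : List (List ι)} (h : LL.flatten.Nodup) {C D : List ι} (hC : C ∈ LL)
    (hD : D ∈ LL) : C = D ∨ C.Disjoint D := by
  by_cases e : C = D
  · exact Or.inl e
  · have : Std.Symm (List.Disjoint (α := ι)) := ⟨fun _ _ h => h.symm⟩
    exact Or.inr ((List.nodup_flatten.1 h).2.forall hC hD e)

/-- As `s k` exceeds the next parameter by 1, the row of `k` acts as `1 - ∑ p k l`, the classical
factor that extends an antisymmetrizer by one index. -/
theorem BrauerRelations.tri_rFactor_isAlt {p q : ι → ι → B} (h : BrauerRelations p q) {s : ι → F}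
    (hs : ∀ a b, a ≠ b → s a ≠ s b) {C : List ι} (hC : C.Nodup)
    (hch : C.IsChain fun a b => s a - s b = 1) : IsAlt p C (tri (rFactor s p) C) := by
  induction C with
  | nil => intro a ha; simp at ha
  | cons k C ih =>
    have hC' := List.nodup_cons.1 hC
    have ih := ih hC'.2 hch.of_cons
    have hk : ∀ a ∈ C, a ≠ k := by rintro a ha rfl; exact hC'.1 ha
    rw [tri, h.row_rFactor_mul ih hC hch.of_cons fun l hl => sub_ne_zero.2 (hs k l (hk l hl).symm)]
    have key : ∀ a ∈ C, p k a * (topFactor s p k C * tri (rFactor s p) C) =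
        -(topFactor s p k C * tri (rFactor s p) C) := by
      intro a ha
      generalize tri (rFactor s p) C = X at ih
      have e : topFactor s p k C = 1 - (C.map (p k)).sum := by
        cases C with
        | nil => simp at ha
        | cons b C =>
          rw [List.isChain_cons_cons] at hch
          rw [topFactor, hch.1, inv_one, one_smul]
      rw [e]
      obtain ⟨C₁, C₂, rfl⟩ := List.append_of_mem ha
      have hS : p k a * ((C₁ ++ C₂).map (p k)).sum * X = -(((C₁ ++ C₂).map (p k)).sum * X) :=
        mul_sum_mul fun l hl => by
          have hlC : l ∈ C₁ ++ a :: C₂ := by simp at hl ⊢; tauto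
          have hla : a ≠ l := by
            rintro rfl
            have := hC'.2
            rw [List.nodup_middle, List.nodup_cons] at this
            exact this.1 hl
          rw [h.p_braid (by simp [(hk a ha).symm, (hk l hlC).symm, hla]), mul_assoc,
            ih a ha l hlC hla, mul_neg]
      have hsum : ((C₁ ++ a :: C₂).map (p k)).sum = p k a + ((C₁ ++ C₂).map (p k)).sum := by
        simp; abel
      rw [hsum]
      generalize ((C₁ ++ C₂).map (p k)).sum = S at hS ⊢
      have e2 := h.p_sq (hk a ha).symm
      calc p k a * ((1 - (p k a + S)) * X)
          = p k a * X - (p k a * p k a) * X - p k a * S * X := by noncomm_ring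
        _ = -((1 - (p k a + S)) * X) := by rw [e2, hS]; noncomm_ring
    intro a ha b hb hab
    rw [List.mem_cons] at ha hb
    rcases ha with rfl | ha
    · exact key b (hb.resolve_left hab.symm)
    rcases hb with rfl | hb
    · rw [h.p_symm]; exact key a ha
    exact ih.mul (fun a ha b hb hab => h.topFactor_commute hC'.2 (iff_of_true ha hb) hab
      (hk a ha) (hk b hb) hC'.1) a ha b hb hab

/-- Columns are treated from the right. Each row collapses by `row_rFactor_mul`, and the
skew-symmetry needed for the next row persists because `topFactor` commutes with transpositions
inside a column. The triangle of a new column, standing on the left, supplies skew-symmetry in that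
column. -/
theorem BrauerRelations.tri_eq_columnProduct {p q : ι → ι → B} (h : BrauerRelations p q)
    {s : ι → F} (hs : ∀ a b, a ≠ b → s a ≠ s b) {LL : List (List ι)} (hn : LL.flatten.Nodup)
    (hch : ∀ C ∈ LL, C.IsChain fun a b => s a - s b = 1) :
    tri (rFactor s p) LL.flatten = columnProduct s p LL ∧
      ∀ C ∈ LL, IsAlt p C (columnProduct s p LL) := by
  induction LL with
  | nil => simp [tri, columnProduct]
  | cons C LL ih =>
    rw [List.flatten_cons] at hn
    obtain ⟨hC, hL, hCL⟩ := List.nodup_append.1 hn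
    obtain ⟨ih1, ih2⟩ := ih hL fun D hD => hch D (by simp [hD])
    have hcomm : ∀ ⦃a b c d⦄, [a, b, c, d].Nodup → Commute (rFactor s p a b) (rFactor s p c d) :=
      fun a b c d hd => (commute_one_sub_smul (commute_one_sub_smul (h.p_comm hd) _).symm _).symm
    have hnot : ∀ k ∈ C, ∀ D ∈ LL, k ∉ D := fun k hk D hD hkD =>
      hCL k hk k (List.mem_flatten.2 ⟨D, hD, hkD⟩) rfl
    have step : ∀ k ∈ C, ∀ X, (∀ D ∈ LL, IsAlt p D X) →
        (LL.map fun C' => (C'.map (rFactor s p k)).prod).prod * X =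
          (LL.map (topFactor s p k)).prod * X ∧
        ∀ D ∈ LL, IsAlt p D ((LL.map (topFactor s p k)).prod * X) := fun k hk X hX =>
      prod_mul_congr (P := fun X => ∀ D ∈ LL, IsAlt p D X) (fun C' hC' X hX => by
        have hn' := (List.nodup_flatten.1 hL).1 C' hC'
        refine ⟨h.row_rFactor_mul (hX C' hC') (List.nodup_cons.2 ⟨hnot k hk C' hC', hn'⟩)
          (hch C' (by simp [hC'])) fun l hl => sub_ne_zero.2 (hs k l ?_), fun D hD =>
          (hX D hD).mul fun a ha b hb hab => h.topFactor_commute hn' ?_ hab ?_ ?_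
            (hnot k hk C' hC')⟩
        · rintro rfl; exact hnot k hk C' hC' hl
        · rcases eq_or_disjoint hL hD hC' with rfl | hd
          · exact iff_of_true ha hb
          · exact iff_of_false (hd ha) (hd hb)
        · rintro rfl; exact hnot a hk D hD ha
        · rintro rfl; exact hnot b hk D hD hb) hX
    have step2 := prod_mul_congr (P := fun X => ∀ D ∈ LL, IsAlt p D X) step ih2
    rw [List.flatten_cons, tri_append hcomm hn, ih1, rect_flatten, columnProduct, mul_assoc,
      step2.1, mul_assoc]
    refine ⟨rfl, fun D hD => ?_⟩
    rw [List.mem_cons] at hD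
    rcases hD with rfl | hD
    · intro a ha b hb hab
      rw [← mul_assoc, h.tri_rFactor_isAlt hs hC (hch D (by simp)) a ha b hb hab, neg_mul]
    · refine (step2.2 D hD).mul fun a ha b hb hab => commute_tri hC fun k hk l hl hkl =>
        commute_one_sub_smul (h.p_comm ?_) _
      have hak : a ≠ k := by rintro rfl; exact hnot a hk D hD ha
      have hal : a ≠ l := by rintro rfl; exact hnot a hl D hD ha
      have hbk : b ≠ k := by rintro rfl; exact hnot b hk D hD hb
      have hbl : b ≠ l := by rintro rfl; exact hnot b hl D hD hb
      simp [hab, hak, hal, hbk, hbl, hkl]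

/-- From `q a b = q a b * p a b` and skew-symmetry, `q a b * X` equals its own negative, hence
vanishes. -/
theorem BrauerRelations.kFactor_mul_isAlt {p q : ι → ι → B} (h : BrauerRelations p q)
    [NeZero (2 : F)] {s : ι → F} {m : F} {C : List ι} {X : B} (hX : IsAlt p C X) {a b : ι}
    (ha : a ∈ C) (hb : b ∈ C) (hab : a ≠ b) : kFactor s m q a b * X = X := by
  have h1 : q a b * X = -(q a b * X) := by
    conv_lhs => rw [← h.q_mul_p hab, mul_assoc, hX a ha b hb hab, mul_neg]
  have h2 : (2 : F) • (q a b * X) = 0 := by rw [two_smul]; nth_rw 1 [h1]; simp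
  have h3 : q a b * X = 0 := by
    have := congrArg (fun y => (2 : F)⁻¹ • y) h2
    simpa [smul_smul, NeZero.ne] using this
  rw [kFactor, sub_mul, smul_mul_assoc, h3, smul_zero, sub_zero, one_mul]

theorem BrauerRelations.tri_kFactor_mul_isAlt {p q : ι → ι → B} (h : BrauerRelations p q)
    [NeZero (2 : F)] {s : ι → F} {m : F} {C : List ι} {X : B} (hX : IsAlt p C X) (hC : C.Nodup) :
    tri (kFactor s m q) C * X = X := by
  induction C with
  | nil => simp [tri]
  | cons a C ih =>
    have hC' := List.nodup_cons.1 hC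
    rw [tri, mul_assoc, ih (hX.mono (by simp)) hC'.2]
    have := (prod_mul_congr (P := fun Y => Y = X) (f := kFactor s m q a) (g := fun _ => 1) (L := C)
      (X := X) (fun l hl Y hY => by
        subst hY
        rw [one_mul, h.kFactor_mul_isAlt hX (by simp) (by simp [hl])
          (by rintro rfl; exact hC'.1 hl)]
        exact ⟨rfl, rfl⟩) rfl).1
    simpa using this

variable {κ : Type*} [DecidableEq κ]

/-- The factors of `f` with indices in different columns. -/
def offColumn (col : ι → κ) (f : ι → ι → B) (a b : ι) : B := if col a ≠ col b then f a b else 1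

theorem tri_offColumn_eq_one {col : ι → κ} {f : ι → ι → B} {C : List ι}
    (hC : ∀ a ∈ C, ∀ b ∈ C, col a = col b) : tri (offColumn col f) C = 1 := by
  induction C with
  | nil => rfl
  | cons a C ih =>
    rw [tri, ih fun a ha b hb => hC a (by simp [ha]) b (by simp [hb]), mul_one]
    refine List.prod_eq_one fun x hx => ?_
    obtain ⟨l, hl, rfl⟩ := List.mem_map.1 hx
    simp [offColumn, hC a (by simp) l (by simp [hl])]

/-- The triangle of each column acts as 1 once everything to its right is skew-symmetric in that
column. The work lies in showing that the rectangles of factors between columns keep skew-symmetry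
in every column. -/
theorem BrauerRelations.tri_kFactor_mul {p q : ι → ι → B} (h : BrauerRelations p q)
    [NeZero (2 : F)] {s : ι → F} {m : F} (hm : ∀ a b, s a + s b + m ≠ 0) {col : ι → κ}
    {LL : List (List ι)} (hn : LL.flatten.Nodup)
    (hch : ∀ C ∈ LL, C.IsChain fun a b => s a - s b = 1)
    (hcol : ∀ C ∈ LL, ∀ a ∈ C, ∀ b ∈ C, col a = col b)
    (hcol' : LL.Pairwise fun C D => ∀ a ∈ C, ∀ b ∈ D, col a ≠ col b)
    {X : B} (hX : ∀ C ∈ LL, IsAlt p C X) :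
    tri (kFactor s m q) LL.flatten * X =
      tri (offColumn col (kFactor s m q)) LL.flatten * X ∧
      ∀ C ∈ LL, IsAlt p C (tri (kFactor s m q) LL.flatten * X) := by
  induction LL with
  | nil => simp [tri]
  | cons C LL ih =>
    rw [List.flatten_cons] at hn
    obtain ⟨hC, hL, hCL⟩ := List.nodup_append.1 hn
    rw [List.pairwise_cons] at hcol'
    obtain ⟨ih1, ih2⟩ := ih hL (fun D hD => hch D (by simp [hD]))
      (fun D hD => hcol D (by simp [hD])) hcol'.2 fun D hD => hX D (by simp [hD])
    have hcomm : ∀ ⦃a b c d⦄, [a, b, c, d].Nodup →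
        Commute (kFactor s m q a b) (kFactor s m q c d) := fun a b c d hd =>
      (commute_one_sub_smul (commute_one_sub_smul (h.q_comm hd) _).symm _).symm
    have hcomm' : ∀ ⦃a b c d⦄, [a, b, c, d].Nodup →
        Commute (offColumn col (kFactor s m q) a b) (offColumn col (kFactor s m q) c d) := by
      intro a b c d hd
      unfold offColumn
      split_ifs <;> first | exact hcomm hd | exact Commute.one_right _ | exact Commute.one_left _
    have hnot : ∀ k ∈ C, ∀ D ∈ LL, k ∉ D := fun k hk D hD hkD =>
      hCL k hk k (List.mem_flatten.2 ⟨D, hD, hkD⟩) rfl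
    set Y := tri (kFactor s m q) LL.flatten * X with hY
    have hYC : IsAlt p C Y := (hX C (by simp)).mul fun a ha b hb hab =>
      commute_tri hL fun k hk l hl hkl => commute_one_sub_smul (h.pq_comm (by
        simp [hab, hCL a ha k hk, hCL a ha l hl, hCL b hb k hk, hCL b hb l hl, hkl])) _
    -- Reordering the rectangle by the entries of the later columns produces complete rows over `C`,
    -- to which `row_kFactor_isAlt` applies.
    have hrC : IsAlt p C (rect (kFactor s m q) C LL.flatten * Y) := by
      rw [rect_swap hC hL fun k hk k' hk' l hl l' hl' hkk hll => hcomm (by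
        simp [hkk, hll, hCL k hk l hl, hCL k hk l' hl', (hCL k' hk' l hl).symm,
          hCL k' hk' l' hl'])]
      refine (prod_mul_congr (P := IsAlt p C) (fun l hl Z hZ => ⟨rfl, ?_⟩) hYC).2
      have e : (fun k => kFactor s m q k l) = kFactor s m q l := by
        funext k; rw [kFactor, kFactor, h.q_symm k l, add_comm (s k)]
      have hlC : l ∉ C := fun hlC => hCL l hlC l hl rfl
      rw [e]
      exact h.row_kFactor_isAlt hZ (List.nodup_cons.2 ⟨hlC, hC⟩) (hch C (by simp))
        (fun _ _ => hm _ _) hZ hlC (Or.inl rfl)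
    have hrL : ∀ D ∈ LL, IsAlt p D (rect (kFactor s m q) C LL.flatten * Y) := by
      rw [rect_flatten]
      refine (prod_mul_congr (P := fun Z => ∀ D ∈ LL, IsAlt p D Z)
        (fun k hk Z hZ => ⟨rfl, ?_⟩) ih2).2
      refine (prod_mul_congr (P := fun Z => ∀ D ∈ LL, IsAlt p D Z)
        (fun C' hC' Z hZ => ⟨rfl, fun D hD => ?_⟩) hZ).2
      exact h.row_kFactor_isAlt (hZ C' hC')
        (List.nodup_cons.2 ⟨hnot k hk C' hC', (List.nodup_flatten.1 hL).1 C' hC'⟩)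
        (hch C' (by simp [hC'])) (fun _ _ => hm _ _) (hZ D hD) (hnot k hk D hD)
        (eq_or_disjoint hL hD hC')
    have e1 : rect (offColumn col (kFactor s m q)) C LL.flatten =
        rect (kFactor s m q) C LL.flatten := by
      unfold rect
      congr 1
      refine List.map_congr_left fun k hk => ?_
      congr 1
      refine List.map_congr_left fun l hl => ?_
      obtain ⟨D, hD, hl⟩ := List.mem_flatten.1 hl
      exact if_pos (hcol'.1 D hD k hk l hl)
    rw [List.flatten_cons, tri_append hcomm hn, tri_append hcomm' hn, e1,
      tri_offColumn_eq_one (hcol C (by simp)), one_mul, mul_assoc, mul_assoc _ _ X, ← ih1, ← hY,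
      mul_assoc, h.tri_kFactor_mul_isAlt hrC hC]
    refine ⟨rfl, fun D hD => ?_⟩
    rw [List.mem_cons] at hD
    rcases hD with rfl | hD
    · exact hrC
    · exact hrL D hD

/-- The relations used for the fusion procedure, for elements of a Brauer algebra
indexed by a list of columns. -/
theorem BrauerRelations.fusion {p q : ι → ι → B} (h : BrauerRelations p q)
    [NeZero (2 : F)] {s : ι → F} {m : F} (hs : ∀ a b, a ≠ b → s a ≠ s b)
    (hm : ∀ a b, s a + s b + m ≠ 0) {col : ι → κ}
    {LL : List (List ι)} (hn : LL.flatten.Nodup)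
    (hch : ∀ C ∈ LL, C.IsChain fun a b => s a - s b = 1)
    (hcol : ∀ C ∈ LL, ∀ a ∈ C, ∀ b ∈ C, col a = col b)
    (hcol' : LL.Pairwise fun C D => ∀ a ∈ C, ∀ b ∈ D, col a ≠ col b) :
    tri (kFactor s m q) LL.flatten * tri (rFactor s p) LL.flatten =
        tri (offColumn col (kFactor s m q)) LL.flatten * tri (rFactor s p) LL.flatten ∧
      tri (offColumn col (kFactor s m q)) LL.flatten * tri (rFactor s p) LL.flatten =
        tri (rFactor s p) LL.flatten * triRev (offColumn col (kFactor s m q)) LL.flatten := by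
  have hyb := h.yangBaxter hs hm
  have key := (h.tri_kFactor_mul hm hn hch hcol hcol'
    (h.tri_eq_columnProduct hs hn hch).2).1
  -- In the opposite algebra the same lemma removes the in-column factors standing to the right of
  -- the product of `rFactor`s.
  have key' := (h.op.tri_kFactor_mul hm hn hch hcol hcol'
    (h.op.tri_eq_columnProduct hs hn hch).2).1
  rw [← (h.tri_eq_columnProduct hs hn hch).1] at key
  have e1 : rFactor s (fun a b => MulOpposite.op (p a b)) =
      fun a b => MulOpposite.op (rFactor s p a b) := by
    funext a b; simp [rFactor]
  have e2 : kFactor s m (fun a b => MulOpposite.op (q a b)) =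
      fun a b => MulOpposite.op (kFactor s m q a b) := by
    funext a b; simp [kFactor]
  have e3 : offColumn col (fun a b => MulOpposite.op (kFactor s m q a b)) =
      fun a b => MulOpposite.op (offColumn col (kFactor s m q) a b) := by
    funext a b; unfold offColumn; split_ifs <;> simp
  rw [← (h.op.tri_eq_columnProduct hs hn hch).1, e1, e2, e3, tri_op, tri_op, tri_op,
    ← MulOpposite.op_mul, ← MulOpposite.op_mul] at key'
  have key' := MulOpposite.op_injective key'
  rw [← hyb.tri_eq_triRev hn, ← hyb.tri_mul_tri hn, key] at key'
  exact ⟨key, key'⟩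

end Columns

/-! ### Values of products of rational functions. -/

section Values

variable {σ : Type} {A : Type} [Ring A] [Algebra ℂ A]

theorem hasValueAt_one (p : σ → ℂ) : HasValueAt (1 : RatField σ ⊗[ℂ] A) p 1 :=
  ⟨1, 1, by simp, by simp, by simp⟩

theorem HasValueAt.mul {F G : RatField σ ⊗[ℂ] A} {p : σ → ℂ} {v w : A} (hF : HasValueAt F p v)
    (hG : HasValueAt G p w) : HasValueAt (F * G) p (v * w) := by
  obtain ⟨g, F', hg, hF, rfl⟩ := hF
  obtain ⟨h, G', hh, hG, rfl⟩ := hG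
  refine ⟨g * h, F' * G', by simp [hg, hh], ?_, ?_⟩
  · rw [map_mul, map_mul, ← hF, ← hG, smul_mul_smul_comm]
  · rw [map_mul, map_mul, smul_mul_smul_comm, mul_inv]

theorem HasValueAt.list_prod {α : Type*} {f : α → RatField σ ⊗[ℂ] A} {g : α → A} {p : σ → ℂ}
    {L : List α} (h : ∀ x ∈ L, HasValueAt (f x) p (g x)) :
    HasValueAt (L.map f).prod p (L.map g).prod := by
  induction L with
  | nil => exact hasValueAt_one p
  | cons a L ih =>
    rw [List.map_cons, List.map_cons, List.prod_cons, List.prod_cons]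
    exact (h a (by simp)).mul (ih fun x hx => h x (by simp [hx]))

theorem hasValueAt_factor {f : MvPolynomial σ ℂ} {p : σ → ℂ} (hf : MvPolynomial.eval p f ≠ 0)
    (T : A) : HasValueAt (1 - (algebraMap (MvPolynomial σ ℂ) (RatField σ) f)⁻¹ •
      ((1 : RatField σ) ⊗ₜ[ℂ] T)) p (1 - (MvPolynomial.eval p f)⁻¹ • T) := by
  have h0 : algebraMap (MvPolynomial σ ℂ) (RatField σ) f ≠ 0 := by
    rw [Ne, FaithfulSMul.algebraMap_eq_zero_iff]
    rintro rfl; simp at hf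
  refine ⟨f, f • 1 - (1 : MvPolynomial σ ℂ) ⊗ₜ[ℂ] T, hf, ?_, ?_⟩
  · rw [map_sub, polyToRat_smul, map_one, smul_sub, smul_smul, mul_inv_cancel₀ h0, one_smul]
    simp [polyToRat]
  · rw [map_sub, polyEval_smul, map_one, smul_sub, smul_smul, inv_mul_cancel₀ hf, one_smul]
    simp [polyEval]

theorem HasValueAt.tri {ι : Type*} {f : ι → ι → RatField σ ⊗[ℂ] A} {g : ι → ι → A} {p : σ → ℂ}
    {L : List ι} (hL : L.Nodup)
    (h : ∀ a ∈ L, ∀ b ∈ L, a ≠ b → HasValueAt (f a b) p (g a b)) :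
    HasValueAt (BrauerFusion.tri f L) p (BrauerFusion.tri g L) := by
  induction L with
  | nil => exact hasValueAt_one p
  | cons a L ih =>
    rw [List.nodup_cons] at hL
    refine HasValueAt.mul (.list_prod fun l hl => h a (by simp) l (by simp [hl]) ?_)
      (ih hL.2 fun a ha b hb => h a (by simp [ha]) b (by simp [hb]))
    rintro rfl; exact hL.1 hl

theorem HasValueAt.triRev {ι : Type*} {f : ι → ι → RatField σ ⊗[ℂ] A} {g : ι → ι → A} {p : σ → ℂ}
    {L : List ι} (hL : L.Nodup)
    (h : ∀ a ∈ L, ∀ b ∈ L, a ≠ b → HasValueAt (f a b) p (g a b)) :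
    HasValueAt (BrauerFusion.triRev f L) p (BrauerFusion.triRev g L) := by
  induction L with
  | nil => exact hasValueAt_one p
  | cons a L ih =>
    rw [List.nodup_cons] at hL
    refine HasValueAt.mul (ih hL.2 fun a ha b hb => h a (by simp [ha]) b (by simp [hb]))
      (.list_prod fun l hl => h a (by simp) l (by simp at hl; simp [hl]) ?_)
    rintro rfl; simp at hl; exact hL.1 hl

end Values

/-! ### The operators `P_kl` and `Q_kl` satisfy the Brauer relations. -/

section Operators

variable {N n : ℕ}

/-- The tensor products of the standard basis vectors. -/
def basisTensor (I : Fin n → Fin N) : TensorPower N n :=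
  PiTensorProduct.tprod ℂ fun m => Pi.single (I m) (1 : ℂ)

theorem op_ext {S T : Op N n} (h : ∀ I, S (basisTensor I) = T (basisTensor I)) : S = T := by
  refine PiTensorProduct.ext (Module.Basis.ext_multilinear (fun _ => Pi.basisFun ℂ (Fin N)) ?_)
  intro I
  simpa [basisTensor] using h I

theorem opP_basisTensor (k l : Fin n) (I : Fin n → Fin N) :
    opP N k l (basisTensor I) = basisTensor fun m => I (Equiv.swap k l m) := by
  rw [basisTensor, opP_tprod]; rfl

theorem opQ_basisTensor {k l : Fin n} (hkl : k ≠ l) (I : Fin n → Fin N) :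
    opQ N k l (basisTensor I) = if I k = I l then
      ∑ x : Fin N, basisTensor (Function.update (Function.update I k x) l x) else 0 := by
  have e : ∀ x : Fin N, PiTensorProduct.tprod ℂ (Function.update (Function.update
      (fun m => (Pi.single (I m) 1 : Fin N → ℂ)) k (Pi.single x 1)) l (Pi.single x 1)) =
      basisTensor (Function.update (Function.update I k x) l x) := by
    intro x
    rw [basisTensor]
    congr 1
    funext m
    by_cases h1 : m = l
    · subst h1; simp
    by_cases h2 : m = k
    · subst h2; simp [h1]
    simp [h1, h2]
  rw [basisTensor, opQ_tprod N hkl]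
  simp only [e]
  split_ifs with h
  · simp [h]
  · simp [h]

/-- Most relations reduce on basis tensors to identities between permuted or updated multi-indices;
the commutation of disjoint contractions is checked on matrix units, factor by factor. -/
theorem brauerRelations_op (N n : ℕ) : BrauerRelations (opP N (n := n)) (opQ N (n := n)) where
  p_symm a b := by rw [opP, opP, Equiv.swap_comm]
  q_symm a b := by simp only [opQ, or_comm]
  p_sq a b hab := op_ext fun I => by
    simp [opP_basisTensor]
  p_comm a b c d hn := op_ext fun I => by
    simp only [Module.End.mul_apply, opP_basisTensor]
    congr 1; funext m
    simp at hn
    grind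
  pq_comm a b c d hn := op_ext fun I => by
    simp at hn
    simp only [Module.End.mul_apply, opP_basisTensor, opQ_basisTensor hn.2.2]
    rw [Equiv.swap_apply_of_ne_of_ne (by tauto) (by tauto),
      Equiv.swap_apply_of_ne_of_ne (by tauto) (by tauto)]
    split_ifs
    · simp only [map_sum, opP_basisTensor]
      refine Finset.sum_congr rfl fun x _ => ?_
      congr 1; funext m
      grind [Function.update_apply]
    · simp
  q_comm a b c d hn := by
    simp at hn
    refine Commute.sum_left _ _ _ fun x _ => Commute.sum_left _ _ _ fun y _ =>
      Commute.sum_right _ _ _ fun z _ => Commute.sum_right _ _ _ fun w _ => ?_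
    rw [Commute, SemiconjBy, ← PiTensorProduct.map_mul, ← PiTensorProduct.map_mul]
    congr 1; funext m
    split_ifs
    · grind
    · rfl
    · rfl
    · rfl
  p_braid a b c hn := op_ext fun I => by
    simp only [Module.End.mul_apply, opP_basisTensor]
    congr 1; funext m
    simp at hn
    grind
  p_mul_q a b hab := op_ext fun I => by
    simp only [Module.End.mul_apply, opQ_basisTensor hab]
    split_ifs
    · simp only [map_sum, opP_basisTensor]
      refine Finset.sum_congr rfl fun x _ => ?_
      congr 1; funext m
      grind [Function.update_apply]
    · simp
  q_mul_p a b hab := op_ext fun I => by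
    simp only [Module.End.mul_apply, opQ_basisTensor hab, opP_basisTensor, Equiv.swap_apply_left,
      Equiv.swap_apply_right, eq_comm (a := I b)]
    split_ifs
    · refine Finset.sum_congr rfl fun x _ => ?_
      congr 1; funext m
      grind [Function.update_apply]
    · simp
  p_conj_q a b c hn := op_ext fun I => by
    simp at hn
    have hbc : b ≠ c := hn.2
    have hac : a ≠ c := hn.1.2
    simp only [Module.End.mul_apply, opP_basisTensor, opQ_basisTensor hbc, opQ_basisTensor hac]
    rw [Equiv.swap_apply_right, Equiv.swap_apply_of_ne_of_ne hac.symm hbc.symm]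
    split_ifs
    · simp only [map_sum, opP_basisTensor]
      refine Finset.sum_congr rfl fun x _ => ?_
      congr 1; funext m
      grind [Function.update_apply]
    · simp
  q_mul_q a b c hn := op_ext fun I => by
    simp at hn
    have hbc : b ≠ c := hn.2
    have hac : a ≠ c := hn.1.2
    have hab : a ≠ b := hn.1.1
    simp only [Module.End.mul_apply, opP_basisTensor, opQ_basisTensor hbc, opQ_basisTensor hac]
    rw [Equiv.swap_apply_left, Equiv.swap_apply_of_ne_of_ne hac.symm hbc.symm]
    split_ifs
    · simp only [map_sum, opQ_basisTensor hac, Function.update_self, Function.update_of_ne hac,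
        Function.update_of_ne hab]
      rw [Finset.sum_ite_eq Finset.univ (I a), if_pos (Finset.mem_univ _)]
      refine Finset.sum_congr rfl fun x _ => ?_
      congr 1; funext m
      grind [Function.update_apply]
    · simp

end Operators

/-! ### Splitting sorted lists into columns; ordered products over pairs. -/

section Lists

theorem exists_columns {ι κ : Type*} [LinearOrder κ] (col : ι → κ) {L : List ι}
    (hL : L.Pairwise fun a b => col a ≤ col b) :
    ∃ LL : List (List ι), LL.flatten = L ∧ (∀ C ∈ LL, C ≠ []) ∧
      (∀ C ∈ LL, ∀ a ∈ C, ∀ b ∈ C, col a = col b) ∧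
      LL.Pairwise fun C D => ∀ a ∈ C, ∀ b ∈ D, col a < col b := by
  induction L with
  | nil => exact ⟨[], by simp⟩
  | cons a L ih =>
    rw [List.pairwise_cons] at hL
    obtain ⟨LL, rfl, h1, h2, h3⟩ := ih hL.2
    cases LL with
    | nil => exact ⟨[[a]], by simp⟩
    | cons C LL =>
      obtain ⟨c, hc⟩ := List.exists_mem_of_ne_nil C (h1 C (by simp))
      rw [List.pairwise_cons] at h3
      rcases (hL.1 c (by simp [hc])).lt_or_eq with hlt | heq
      · refine ⟨[a] :: C :: LL, by simp, by simpa using h1, ?_, ?_⟩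
        · intro D hD
          rw [List.mem_cons] at hD
          rcases hD with rfl | hD
          · simp
          · exact h2 D hD
        · rw [List.pairwise_cons, List.pairwise_cons]
          refine ⟨fun D hD x hx y hy => ?_, h3⟩
          rw [List.mem_singleton] at hx
          subst hx
          rw [List.mem_cons] at hD
          rcases hD with rfl | hD
          · rwa [h2 D (by simp) y hy c hc]
          · exact hlt.trans (h3.1 D hD c hc y hy)
      · have hac : ∀ x ∈ C, col a = col x := fun x hx => heq.trans (h2 C (by simp) c hc x hx)
        refine ⟨(a :: C) :: LL, by simp, ?_, ?_, ?_⟩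
        · intro D hD
          rw [List.mem_cons] at hD
          rcases hD with rfl | hD
          · simp
          · exact h1 D (by simp [hD])
        · intro D hD
          rw [List.mem_cons] at hD
          rcases hD with rfl | hD
          · intro x hx y hy
            rw [List.mem_cons] at hx hy
            rcases hx with rfl | hx <;> rcases hy with rfl | hy
            · rfl
            · exact hac y hy
            · exact (hac x hx).symm
            · exact h2 C (by simp) x hx y hy
          · exact h2 D (by simp [hD])
        · rw [List.pairwise_cons]
          refine ⟨fun D hD x hx y hy => ?_, h3.2⟩
          rw [List.mem_cons] at hx
          rcases hx with rfl | hx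
          · rw [heq]; exact h3.1 D hD c hc y hy
          · exact h3.1 D hD x hx y hy

theorem isChain_finRange (n : ℕ) : (List.finRange n).IsChain fun a b : Fin n => (b : ℕ) = a + 1 := by
  rw [List.isChain_iff_getElem]
  intro i hi
  simp

/-- Connects the products over filtered lists of pairs with the recursive `tri`, on which the
inductions run. -/
theorem prod_filter_product_eq_tri {ι B : Type*} [LinearOrder ι] [Ring B] (g : ι × ι → B)
    {L : List ι} (hL : L.Pairwise (· < ·)) :
    (((L.product L).filter fun q => q.1 < q.2).map g).prod = tri (fun a b => g (a, b)) L := by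
  induction L with
  | nil => rfl
  | cons a L ih =>
    rw [List.pairwise_cons] at hL
    have h1 : (L.map (Prod.mk a)).filter (fun q => q.1 < q.2) = L.map (Prod.mk a) := by
      rw [List.filter_eq_self]
      intro q hq
      obtain ⟨l, hl, rfl⟩ := List.mem_map.1 hq
      simpa using hL.1 l hl
    have h2 : (L.product (a :: L)).filter (fun q => q.1 < q.2) =
        (L.product L).filter fun q => q.1 < q.2 := by
      change (L.flatMap fun b => (a :: L).map (Prod.mk b)).filter _ =
        (L.flatMap fun b => L.map (Prod.mk b)).filter _
      rw [List.filter_flatMap, List.filter_flatMap, List.flatMap_def, List.flatMap_def]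
      congr 1
      refine List.map_congr_left fun b hb => ?_
      rw [List.map_cons, List.filter_cons_of_neg]
      simpa using (hL.1 b hb).le
    have h3 : (a :: L).product (a :: L) =
        (a, a) :: (L.map (Prod.mk a) ++ L.product (a :: L)) := rfl
    rw [h3, List.filter_cons_of_neg (by simp), List.filter_append, h1, h2, List.map_append,
      List.prod_append, ih hL.2, List.map_map, tri]
    rfl

theorem prod_map_filter {α B : Type*} [Monoid B] (g : α → B) (P : α → Prop) [DecidablePred P]
    (L : List α) : ((L.filter P).map g).prod = (L.map fun x => if P x then g x else 1).prod := by
  induction L with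
  | nil => rfl
  | cons a L ih => by_cases h : P a <;> simp [h, ih]

end Lists

/-! ### Regularity and membership for the column form of `R`. -/

section Values

variable {ι : Type*} {σ : Type} {A : Type} [Ring A] [Algebra ℂ A]

theorem hasValueAt_rFactor (f : ι → MvPolynomial σ ℂ) (P : ι → ι → A) {z : σ → ℂ} {a b : ι}
    (h : MvPolynomial.eval z (f a) ≠ MvPolynomial.eval z (f b)) :
    HasValueAt (rFactor (fun k => algebraMap (MvPolynomial σ ℂ) (RatField σ) (f k))
      (fun a b => (1 : RatField σ) ⊗ₜ[ℂ] P a b) a b) z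
      (rFactor (fun k => MvPolynomial.eval z (f k)) P a b) := by
  have := hasValueAt_factor (f := f a - f b) (p := z) (by rwa [map_sub, sub_ne_zero]) (P a b)
  rwa [map_sub, map_sub] at this

theorem hasValueAt_kFactor (f : ι → MvPolynomial σ ℂ) (m : ℕ) (Q : ι → ι → A) {z : σ → ℂ}
    {a b : ι} (h : MvPolynomial.eval z (f a) + MvPolynomial.eval z (f b) + m ≠ 0) :
    HasValueAt (kFactor (fun k => algebraMap (MvPolynomial σ ℂ) (RatField σ) (f k)) (m : RatField σ)
      (fun a b => (1 : RatField σ) ⊗ₜ[ℂ] Q a b) a b) z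
      (kFactor (fun k => MvPolynomial.eval z (f k)) (m : ℂ) Q a b) := by
  have := hasValueAt_factor (f := f a + f b + (m : MvPolynomial σ ℂ)) (p := z)
    (by rwa [map_add, map_add, map_natCast]) (Q a b)
  rwa [map_add, map_add, map_natCast, map_add, map_add, map_natCast] at this

theorem hasValueAt_topFactor (f : ι → MvPolynomial σ ℂ) (P : ι → ι → A) {z : σ → ℂ} {k : ι}
    {C : List ι} (h : ∀ a ∈ C.head?, MvPolynomial.eval z (f k) ≠ MvPolynomial.eval z (f a)) :
    HasValueAt (topFactor (fun k => algebraMap (MvPolynomial σ ℂ) (RatField σ) (f k))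
      (fun a b => (1 : RatField σ) ⊗ₜ[ℂ] P a b) k C) z
      (topFactor (fun k => MvPolynomial.eval z (f k)) P k C) := by
  cases C with
  | nil => exact hasValueAt_one z
  | cons a C =>
    have := hasValueAt_factor (f := f k - f a) (p := z)
      (by rw [map_sub, sub_ne_zero]; exact h a (by simp)) ((a :: C).map (P k)).sum
    rw [map_sub, map_sub] at this
    have e : (1 : RatField σ) ⊗ₜ[ℂ] ((a :: C).map (P k)).sum =
        ((a :: C).map fun l => (1 : RatField σ) ⊗ₜ[ℂ] P k l).sum := by
      change Algebra.TensorProduct.includeRight (((a :: C).map (P k)).sum) = _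
      rw [map_list_sum, List.map_map]
      rfl
    rwa [e] at this

/-- Denominators come only from pairs inside a column and from pairs of an entry with the head of a
later column. -/
theorem hasValueAt_columnProduct (f : ι → MvPolynomial σ ℂ) (P : ι → ι → A) {z : σ → ℂ}
    {LL : List (List ι)} (hn : LL.flatten.Nodup)
    (h : ∀ C ∈ LL, ∀ a ∈ C, ∀ b ∈ C, a ≠ b →
      MvPolynomial.eval z (f a) ≠ MvPolynomial.eval z (f b))
    (h' : LL.Pairwise fun C D => ∀ k ∈ C, ∀ a ∈ D.head?,
      MvPolynomial.eval z (f k) ≠ MvPolynomial.eval z (f a)) :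
    HasValueAt (columnProduct (fun k => algebraMap (MvPolynomial σ ℂ) (RatField σ) (f k))
      (fun a b => (1 : RatField σ) ⊗ₜ[ℂ] P a b) LL) z
      (columnProduct (fun k => MvPolynomial.eval z (f k)) P LL) := by
  induction LL with
  | nil => exact hasValueAt_one z
  | cons C LL ih =>
    rw [List.flatten_cons] at hn
    obtain ⟨hC, hL, -⟩ := List.nodup_append.1 hn
    rw [List.pairwise_cons] at h'
    refine HasValueAt.mul (HasValueAt.mul (.tri hC fun a ha b hb hab =>
      hasValueAt_rFactor f P (h C (by simp) a ha b hb hab))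
      (.list_prod fun k hk => .list_prod fun D hD => hasValueAt_topFactor f P (h'.1 D hD k hk)))
      (ih hL (fun D hD => h D (by simp [hD])) h'.2)

/-- Only differences of parameters occur; hence the value of `R` is the same at all points of the
diagonal. -/
theorem columnProduct_add_const {F B : Type*} [Field F] [Ring B] [Algebra F B] (c : ι → F) (z : F)
    (p : ι → ι → B) (LL : List (List ι)) :
    columnProduct (fun k => c k + z) p LL = columnProduct c p LL := by
  have h1 : rFactor (fun k => c k + z) p = rFactor c p := by
    funext a b; simp [rFactor]
  have h2 : topFactor (fun k => c k + z) p = topFactor c p := by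
    funext k C; cases C <;> simp [topFactor]
  induction LL with
  | nil => rfl
  | cons C LL ih => rw [columnProduct, columnProduct, ih, h1, h2]

theorem one_sub_smul_mem {F B : Type*} [Field F] [Ring B] [Algebra F B] {S : Subalgebra F B}
    {x : B} (hx : x ∈ S) (c : F) : 1 - c • x ∈ S :=
  S.sub_mem S.one_mem (S.smul_mem hx c)

theorem columnProduct_mem {F B : Type*} [Field F] [Ring B] [Algebra F B] {S : Subalgebra F B}
    (c : ι → F) {p : ι → ι → B} (hp : ∀ a b, p a b ∈ S) (LL : List (List ι)) :
    columnProduct c p LL ∈ S := by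
  have hr : ∀ a b, rFactor c p a b ∈ S := fun a b => one_sub_smul_mem (hp a b) _
  have ht : ∀ k C, topFactor c p k C ∈ S := by
    intro k C
    cases C with
    | nil => exact S.one_mem
    | cons a C =>
      refine one_sub_smul_mem (S.list_sum_mem fun x hx => ?_) _
      obtain ⟨l, -, rfl⟩ := List.mem_map.1 hx
      exact hp k l
  have htri : ∀ L : List ι, tri (rFactor c p) L ∈ S := by
    intro L
    induction L with
    | nil => exact S.one_mem
    | cons a L ih =>
      refine S.mul_mem (S.list_prod_mem fun x hx => ?_) ih
      obtain ⟨l, -, rfl⟩ := List.mem_map.1 hx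
      exact hr a l
  induction LL with
  | nil => exact S.one_mem
  | cons C LL ih =>
    refine S.mul_mem (S.mul_mem (htri C) (S.list_prod_mem fun x hx => ?_)) ih
    obtain ⟨k, -, rfl⟩ := List.mem_map.1 hx
    refine S.list_prod_mem fun x hx => ?_
    obtain ⟨D, -, rfl⟩ := List.mem_map.1 hx
    exact ht k D

end Values

/-! ### Contents in the column tableau of a skew diagram. -/

section Tableau

variable {lam mu : YoungDiagram}

theorem box_mem (k : Fin (size lam mu)) :
    ((box lam mu k).2, (box lam mu k).1) ∈ lam ∧ ((box lam mu k).2, (box lam mu k).1) ∉ mu := by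
  have h := (boxes lam mu).orderEmbOfFin_mem rfl k
  obtain ⟨⟨i, j⟩, hb, e⟩ := Finset.mem_image.1 h
  rw [Finset.mem_sdiff, YoungDiagram.mem_cells, YoungDiagram.mem_cells] at hb
  have e' : box lam mu k = (j, i) := congrArg ofLex e.symm
  rw [e']
  exact hb

theorem exists_box {i j : ℕ} (h : (i, j) ∈ lam) (h' : (i, j) ∉ mu) :
    ∃ k, box lam mu k = (j, i) := by
  have hm : toLex (j, i) ∈ boxes lam mu := by
    rw [boxes, Finset.mem_image]
    exact ⟨(i, j), by simp [h, h'], rfl⟩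
  have : toLex (j, i) ∈ Set.range ((boxes lam mu).orderEmbOfFin rfl) := by
    rw [Finset.range_orderEmbOfFin]; exact hm
  obtain ⟨k, hk⟩ := this
  exact ⟨k, congrArg ofLex hk⟩

theorem lt_iff_box {k l : Fin (size lam mu)} : k < l ↔ (box lam mu k).1 < (box lam mu l).1 ∨
    (box lam mu k).1 = (box lam mu l).1 ∧ (box lam mu k).2 < (box lam mu l).2 := by
  exact ((boxes lam mu).orderEmbOfFin rfl).lt_iff_lt.symm.trans Prod.Lex.lt_iff

/-- Columns of a skew diagram have no gaps: otherwise the box just below that of `a` would carry a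
number strictly between `a` and `a + 1`. -/
theorem box_snd_succ {a b : Fin (size lam mu)} (hab : (b : ℕ) = a + 1)
    (hcol : (box lam mu a).1 = (box lam mu b).1) :
    (box lam mu b).2 = (box lam mu a).2 + 1 := by
  have hlt : a < b := by rw [Fin.lt_def]; omega
  have h1 : (box lam mu a).2 < (box lam mu b).2 := by
    rcases lt_iff_box.1 hlt with h | h
    · omega
    · exact h.2
  by_contra hne
  obtain ⟨m, hm⟩ := exists_box (lam := lam) (mu := mu) (i := (box lam mu a).2 + 1)
    (j := (box lam mu a).1)
    (lam.up_left_mem (by omega) hcol.le (box_mem b).1)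
    (fun h => (box_mem a).2 (mu.up_left_mem (by omega) le_rfl h))
  have h2 : a < m := lt_iff_box.2 (by rw [hm]; simp)
  have h3 : m < b := lt_iff_box.2 (by rw [hm]; right; exact ⟨hcol, by simp; omega⟩)
  rw [Fin.lt_def] at h2 h3
  omega

/-- If the contents agreed, the box of `a` would lie strictly below and to the right of that of `k`.
The box directly above `a` would then be in `λ` and, as it is weakly below and to the right of `k`,
outside `μ`, so `a` would not be the top of its column. -/
theorem content_ne_of_column_lt {k a : Fin (size lam mu)} (hka : column lam mu k < column lam mu a)
    (ha : ∀ m, column lam mu m = column lam mu a → a ≤ m) :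
    content lam mu k ≠ content lam mu a := by
  intro h
  have hka : (box lam mu k).1 < (box lam mu a).1 := hka
  rw [content, content] at h
  have hr : (box lam mu k).2 < (box lam mu a).2 := by omega
  obtain ⟨m, hm⟩ := exists_box (lam := lam) (mu := mu) (i := (box lam mu a).2 - 1)
    (j := (box lam mu a).1)
    (lam.up_left_mem (by omega) le_rfl (box_mem a).1)
    (fun h => (box_mem k).2 (mu.up_left_mem (by omega) hka.le h))
  refine absurd (ha m (Subtype.ext
    (show (box lam mu m).1 = (box lam mu a).1 by rw [hm]))) (not_le.2 (lt_iff_box.2 ?_))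
  rw [hm]
  exact Or.inr ⟨rfl, by simp; omega⟩

theorem content_ne_of_column_eq {k l : Fin (size lam mu)} (hkl : k ≠ l)
    (h : column lam mu k = column lam mu l) : content lam mu k ≠ content lam mu l := by
  intro hc
  have h : (box lam mu k).1 = (box lam mu l).1 := congrArg Subtype.val h
  rw [content, content] at hc
  have := lt_iff_box (k := k) (l := l)
  have := lt_iff_box (k := l) (l := k)
  rcases lt_or_gt_of_ne hkl with h1 | h1
  · have := lt_iff_box.1 h1; omega
  · have := lt_iff_box.1 h1; omega

/-- The expression is positive: with rows and columns numbered from 0, the box further left has row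
below `colLen 0`, the other has row below `colLen 1` and column at least 1. -/
theorem content_add_content_ne {N M : ℕ} (hlam : lam.colLen 0 + lam.colLen 1 ≤ N + M)
    {k l : Fin (size lam mu)} (h : column lam mu k ≠ column lam mu l) :
    content lam mu k + content lam mu l + (N : ℤ) + (M : ℤ) - 1 ≠ 0 := by
  have key : ∀ k l : Fin (size lam mu), (box lam mu k).1 < (box lam mu l).1 →
      content lam mu k + content lam mu l + (N : ℤ) + (M : ℤ) - 1 ≠ 0 := by
    intro k l hkl
    have h1 := (YoungDiagram.mem_iff_lt_colLen.1 (box_mem k).1).trans_le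
      (lam.colLen_anti 0 _ (Nat.zero_le _))
    have h2 := (YoungDiagram.mem_iff_lt_colLen.1 (box_mem l).1).trans_le
      (lam.colLen_anti 1 _ (by omega))
    rw [content, content]
    omega
  rcases lt_or_gt_of_ne (fun e => h (Subtype.ext e) :
    (box lam mu k).1 ≠ (box lam mu l).1) with h1 | h1
  · exact key k l h1
  · rw [add_comm (content lam mu k)]; exact key l k h1

/-- The division of the entries of the column tableau into columns. -/
theorem exists_tableau_columns (lam mu : YoungDiagram) :
    ∃ LL : List (List (Fin (size lam mu))), LL.flatten = List.finRange _ ∧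
      (∀ C ∈ LL, C.IsChain fun a b => content lam mu a - content lam mu b = 1) ∧
      (∀ C ∈ LL, ∀ a ∈ C, ∀ b ∈ C, column lam mu a = column lam mu b) ∧
      (LL.Pairwise fun C D => ∀ a ∈ C, ∀ b ∈ D, column lam mu a ≠ column lam mu b) ∧
      LL.Pairwise fun C D => ∀ k ∈ C, ∀ a ∈ D.head?, content lam mu k ≠ content lam mu a := by
  have hsort : (List.finRange (size lam mu)).Pairwise
      fun a b => column lam mu a ≤ column lam mu b :=
    (List.pairwise_lt_finRange _).imp fun hab => by
      rcases lt_iff_box.1 hab with h | h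
      · exact h.le
      · exact h.1.le
  obtain ⟨LL, h1, h2, h3, h4⟩ := exists_columns (column lam mu) hsort
  refine ⟨LL, h1, fun C hC => ?_, h3, h4.imp fun h a ha b hb => (h a ha b hb).ne, ?_⟩
  · have hch := isChain_finRange (size lam mu)
    rw [← h1, List.isChain_flatten (by intro h; exact h2 _ h rfl)] at hch
    refine (hch.1 C hC).imp_of_mem_imp fun a b ha hb hab => ?_
    have hcol := congrArg Subtype.val (h3 C hC a ha b hb)
    have hbox := box_snd_succ hab hcol
    change (box lam mu a).1 = (box lam mu b).1 at hcol
    rw [content, content]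
    omega
  -- The head of a block is the top box of its column, as `content_ne_of_column_lt` requires.
  · have hmin : ∀ D ∈ LL, ∀ a ∈ D.head?, ∀ m, column lam mu m = column lam mu a → a ≤ m := by
      intro D hD a ha m hm
      have hm' : m ∈ LL.flatten := by rw [h1]; exact List.mem_finRange m
      obtain ⟨E, hE, hmE⟩ := List.mem_flatten.1 hm'
      have haD : a ∈ D := List.mem_of_mem_head? ha
      have hED : E = D := by
        by_contra hne
        have hsymm : Std.Symm fun C D : List (Fin (size lam mu)) =>
            ∀ a ∈ C, ∀ b ∈ D, column lam mu a ≠ column lam mu b :=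
          ⟨fun _ _ h a ha b hb => (h b hb a ha).symm⟩
        exact (h4.imp (S := fun C D => ∀ a ∈ C, ∀ b ∈ D, column lam mu a ≠ column lam mu b)
          fun h a ha b hb => (h a ha b hb).ne).forall hE hD hne m hmE a haD hm
      subst hED
      have hs : E.Pairwise (· < ·) := (List.pairwise_lt_finRange _).sublist
        (h1 ▸ List.sublist_flatten_of_mem hE)
      cases E with
      | nil => simp at haD
      | cons x E =>
        simp only [List.head?_cons, Option.mem_def, Option.some.injEq] at ha
        subst ha
        rw [List.mem_cons] at hmE
        rcases hmE with rfl | hmE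
        · exact le_rfl
        · exact (List.rel_of_pairwise_cons hs hmE).le
    refine (List.Pairwise.and_mem.1 h4).imp fun ⟨hC, hD, h⟩ k hk a ha => ?_
    exact content_ne_of_column_lt (h k hk a (List.mem_of_mem_head? ha)) (hmin _ hD a ha)

end Tableau

/-! ### The constrained variables and translation to `tri`. -/

section Fusion

variable (lam mu : YoungDiagram) (N M : ℕ)

/-- The polynomial `c_k + t_k`. -/
noncomputable def shiftedVar (k : Fin (size lam mu)) : MvPolynomial (Column lam mu) ℂ :=
  MvPolynomial.C (content lam mu k : ℂ) + MvPolynomial.X (column lam mu k)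

/-- The rational function `c_k + t_k`. -/
noncomputable def shiftedRat (k : Fin (size lam mu)) : RatField (Column lam mu) :=
  algebraMap (MvPolynomial (Column lam mu) ℂ) _ (shiftedVar lam mu k)

theorem shiftedRat_eq (k : Fin (size lam mu)) :
    shiftedRat lam mu k = (content lam mu k : RatField (Column lam mu)) + tvar lam mu k := by
  rw [shiftedRat, shiftedVar, map_add, tvar, ratVar]
  simp

theorem eval_shiftedVar (z : Column lam mu → ℂ) (k : Fin (size lam mu)) :
    MvPolynomial.eval z (shiftedVar lam mu k) = content lam mu k + z (column lam mu k) := by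
  simp [shiftedVar]

variable {lam mu} in
theorem shiftedRat_injective {a b : Fin (size lam mu)} (hab : a ≠ b) :
    shiftedRat lam mu a ≠ shiftedRat lam mu b := by
  intro h
  have h := IsFractionRing.injective (MvPolynomial (Column lam mu) ℂ) (RatField (Column lam mu)) h
  by_cases hc : column lam mu a = column lam mu b
  · have h := congrArg (MvPolynomial.eval fun _ => (0 : ℂ)) h
    rw [eval_shiftedVar, eval_shiftedVar, add_zero, add_zero, Int.cast_inj] at h
    exact content_ne_of_column_eq hab hc h
  -- The point is chosen so that the two sides differ by 1.
  · have h := congrArg (MvPolynomial.eval (Pi.single (column lam mu a)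
      (content lam mu b - content lam mu a + 1 : ℂ))) h
    rw [eval_shiftedVar, eval_shiftedVar, Pi.single_eq_same,
      Pi.single_eq_of_ne (Ne.symm hc)] at h
    have : (1 : ℂ) = 0 := by linear_combination h
    exact one_ne_zero this

theorem shiftedRat_add_ne_zero (m : ℕ) (a b : Fin (size lam mu)) :
    shiftedRat lam mu a + shiftedRat lam mu b + (m : RatField (Column lam mu)) ≠ 0 := by
  intro h
  have h : shiftedVar lam mu a + shiftedVar lam mu b + (m : MvPolynomial (Column lam mu) ℂ) = 0 :=
    IsFractionRing.injective (MvPolynomial (Column lam mu) ℂ) (RatField (Column lam mu)) (by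
      rw [map_add, map_add, map_natCast, map_zero]; exact h)
  -- At this constant point the left-hand side takes the value 1.
  have h := congrArg (MvPolynomial.eval fun _ =>
    ((1 - content lam mu a - content lam mu b - m) / 2 : ℂ)) h
  rw [map_add, map_add, map_natCast, eval_shiftedVar, eval_shiftedVar, map_zero] at h
  have : (1 : ℂ) = 0 := by linear_combination h
  exact one_ne_zero this

theorem fusionP_eq_tri : fusionP lam mu N =
    tri (rFactor (shiftedRat lam mu) fun a b =>
      (1 : RatField (Column lam mu)) ⊗ₜ[ℂ] opP N a b) (List.finRange _) := by
  rw [fusionP, pairs, prod_filter_product_eq_tri _ (List.pairwise_lt_finRange _)]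
  congr 1
  funext a b
  rw [rFactor, shiftedRat_eq, shiftedRat_eq, TensorProduct.smul_tmul', smul_eq_mul, mul_one]
  congr 3
  ring

theorem fusionQ_eq_tri : fusionQ lam mu N M =
    tri (kFactor (shiftedRat lam mu) ((N + M : ℕ) : RatField (Column lam mu))
      fun a b => (1 : RatField (Column lam mu)) ⊗ₜ[ℂ] opQ N a b)
      (List.finRange _) := by
  rw [fusionQ, pairs, prod_filter_product_eq_tri _ (List.pairwise_lt_finRange _)]
  congr 1
  funext a b
  rw [kFactor, shiftedRat_eq, shiftedRat_eq, TensorProduct.smul_tmul', smul_eq_mul, mul_one]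
  congr 3
  push_cast
  ring

theorem prod_columnPairs_eq_tri {B : Type*} [Ring B]
    (g : Fin (size lam mu) × Fin (size lam mu) → B) :
    ((columnPairs lam mu).map g).prod =
      tri (offColumn (column lam mu) fun a b => g (a, b)) (List.finRange _) := by
  rw [columnPairs, prod_map_filter, pairs,
    prod_filter_product_eq_tri _ (List.pairwise_lt_finRange _)]
  rfl

theorem prod_columnPairs_reverse_eq_triRev {B : Type*} [Ring B]
    (g : Fin (size lam mu) × Fin (size lam mu) → B) :
    ((columnPairs lam mu).reverse.map g).prod =
      triRev (offColumn (column lam mu) fun a b => g (a, b)) (List.finRange _) := by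
  apply MulOpposite.op_injective
  have e : (offColumn (column lam mu) fun a b => MulOpposite.op (g (a, b))) =
      fun a b => MulOpposite.op (offColumn (column lam mu) (fun a b => g (a, b)) a b) := by
    funext a b; unfold offColumn; split_ifs <;> simp
  rw [← tri_op, ← e, ← prod_columnPairs_eq_tri lam mu fun q => MulOpposite.op (g q),
    MulOpposite.op_list_prod, List.map_reverse, List.map_reverse, List.reverse_reverse,
    List.map_map]
  rfl

/-- The two values `-1/2` of the variables account for the `-1` in the denominator. -/
theorem factorQ_eq_kFactor (a b : Fin (size lam mu)) : factorQ lam mu N M (a, b) =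
    kFactor (fun k => MvPolynomial.eval (fun _ => (-1 / 2 : ℂ)) (shiftedVar lam mu k))
      ((N + M : ℕ) : ℂ) (opQ N) a b := by
  rw [factorQ, kFactor, eval_shiftedVar, eval_shiftedVar]
  congr 3
  push_cast
  ring

theorem brauerRelations_tensor (n : ℕ) (K : Type) [Field K] [Algebra ℂ K] :
    BrauerRelations (fun a b : Fin n => (1 : K) ⊗ₜ[ℂ] opP N a b) fun a b => 1 ⊗ₜ[ℂ] opQ N a b :=
  (brauerRelations_op N n).map
    (Algebra.TensorProduct.includeRight : Op N n →ₐ[ℂ] K ⊗[ℂ] Op N n).toRingHom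

/-- The generators have `k < l`, whereas `columnProduct_mem` asks for all pairs, including equal
indices. -/
theorem opP_mem_brauerAlgebra {n : ℕ} (a b : Fin n) : opP N a b ∈ brauerAlgebra N n := by
  rcases lt_trichotomy a b with h | rfl | h
  · exact Algebra.subset_adjoin ⟨a, b, h, Or.inl rfl⟩
  · have : opP N a a = 1 := op_ext fun I => by simp [opP_basisTensor]
    rw [this]
    exact Subalgebra.one_mem _
  · rw [(brauerRelations_op N n).p_symm]
    exact Algebra.subset_adjoin ⟨b, a, h, Or.inl rfl⟩

theorem factorQ_mem_brauerAlgebra {q : Fin (size lam mu) × Fin (size lam mu)} (hq : q.1 < q.2) :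
    factorQ lam mu N M q ∈ brauerAlgebra N (size lam mu) := by
  have h : opQ N q.1 q.2 ∈ brauerAlgebra N (size lam mu) :=
    Algebra.subset_adjoin ⟨q.1, q.2, hq, Or.inr rfl⟩
  exact one_sub_smul_mem (B := Op N (size lam mu)) (S := brauerAlgebra N (size lam mu)) h _

variable {lam mu} in
theorem lt_of_mem_columnPairs {q : Fin (size lam mu) × Fin (size lam mu)}
    (hq : q ∈ columnPairs lam mu) : q.1 < q.2 := by
  have h := List.mem_of_mem_filter hq
  simpa using List.of_mem_filter h

end Fusion

end BrauerFusion

/-! ### The fusion procedure for the column tableau. -/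

theorem proposition3 (N M : ℕ) (hN : 0 < N) (lam mu : YoungDiagram)
    (hlam : lam.colLen 0 + lam.colLen 1 ≤ N + M) :
    -- the operator `E_Ω` is well defined as the value of the fusion product at `t_1 = … = t_n`
    (∀ z : ℂ, BrauerFusion.HasValueAt (BrauerFusion.fusionP lam mu N) (fun _ => z)
      (BrauerFusion.opE lam mu N)) ∧
    -- the denominators in the two formulas below do not vanish
    (∀ k l : Fin (BrauerFusion.size lam mu),
      BrauerFusion.column lam mu k ≠ BrauerFusion.column lam mu l →
      BrauerFusion.content lam mu k + BrauerFusion.content lam mu l + (N : ℤ) + (M : ℤ) - 1 ≠ 0) ∧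
    -- the product is regular at `t_1 = … = t_n = -1/2`, with the asserted value
    BrauerFusion.HasValueAt
      (BrauerFusion.fusionQ lam mu N M * BrauerFusion.fusionP lam mu N) (fun _ => -1 / 2)
      (((BrauerFusion.columnPairs lam mu).map (BrauerFusion.factorQ lam mu N M)).prod *
        BrauerFusion.opE lam mu N) ∧
    ((BrauerFusion.columnPairs lam mu).map (BrauerFusion.factorQ lam mu N M)).prod *
        BrauerFusion.opE lam mu N =
      BrauerFusion.opE lam mu N *
        ((BrauerFusion.columnPairs lam mu).reverse.map (BrauerFusion.factorQ lam mu N M)).prod ∧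
    -- the operator `F_Ω(M)` so defined belongs to the Brauer centralizer algebra
    BrauerFusion.opF lam mu N M ∈
      BrauerFusion.brauerAlgebra N (BrauerFusion.size lam mu) := by
  open BrauerFusion in
  obtain ⟨LL, hLL, hch, hcol, hcol', htop⟩ := exists_tableau_columns lam mu
  have hrel := brauerRelations_tensor N (size lam mu) (RatField (Column lam mu))
  have hn : LL.flatten.Nodup := hLL ▸ List.nodup_finRange _
  -- Inside a column the variables coincide and cancel, leaving the difference of contents.
  have hchain : ∀ C ∈ LL, C.IsChain fun a b => shiftedRat lam mu a - shiftedRat lam mu b = 1 :=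
    fun C hC => (hch C hC).imp_of_mem_imp fun a b ha hb hab => by
      rw [shiftedRat_eq, shiftedRat_eq, tvar, tvar, hcol C hC a ha b hb, add_sub_add_right_eq_sub]
      exact_mod_cast congrArg (Int.cast (R := RatField (Column lam mu))) hab
  have hP := (hrel.tri_eq_columnProduct (fun a b => shiftedRat_injective) hn hchain).1
  rw [hLL, ← fusionP_eq_tri] at hP
  have hval : ∀ z : ℂ, HasValueAt (fusionP lam mu N) (fun _ => z)
      (columnProduct (fun k => (content lam mu k : ℂ)) (opP N) LL) := by
    intro z
    have h := hasValueAt_columnProduct (shiftedVar lam mu) (opP N) (z := fun _ => z) hn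
      (fun C hC a ha b hb hab h => by
        rw [eval_shiftedVar, eval_shiftedVar, add_left_inj, Int.cast_inj] at h
        exact content_ne_of_column_eq hab (hcol C hC a ha b hb) h)
      (htop.imp fun h k hk a ha e => by
        rw [eval_shiftedVar, eval_shiftedVar, add_left_inj, Int.cast_inj] at e
        exact h k hk a ha e)
    simp only [eval_shiftedVar, columnProduct_add_const] at h
    rw [hP]
    exact h
  have hE : opE lam mu N = columnProduct (fun k => (content lam mu k : ℂ)) (opP N) LL :=
    valueAt_eq (hval 0)
  have hE' : ∀ z : ℂ, HasValueAt (fusionP lam mu N) (fun _ => z) (opE lam mu N) := by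
    rw [hE]; exact hval
  have hne : ∀ k l : Fin (size lam mu), column lam mu k ≠ column lam mu l →
      content lam mu k + content lam mu l + (N : ℤ) + (M : ℤ) - 1 ≠ 0 :=
    fun k l h => content_add_content_ne hlam h
  -- Provides `2 ≠ 0` for the vanishing of contractions on skew-symmetric elements.
  have : CharZero (RatField (Column lam mu)) := algebraRat.charZero _
  have hfus := hrel.fusion (fun a b => shiftedRat_injective)
    (shiftedRat_add_ne_zero lam mu (N + M)) hn hchain hcol hcol'
  rw [hLL, ← fusionP_eq_tri, ← fusionQ_eq_tri] at hfus
  have hQ : ∀ a b : Fin (size lam mu), HasValueAt (offColumn (column lam mu)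
      (kFactor (shiftedRat lam mu) ((N + M : ℕ) : RatField (Column lam mu))
      fun a b => (1 : RatField (Column lam mu)) ⊗ₜ[ℂ] opQ N a b) a b)
      (fun _ => -1 / 2) (offColumn (column lam mu) (fun a b => factorQ lam mu N M (a, b)) a b) := by
    intro a b
    unfold offColumn
    split_ifs with h
    · change HasValueAt _ _ (factorQ lam mu N M (a, b))
      rw [factorQ_eq_kFactor]
      refine hasValueAt_kFactor (shiftedVar lam mu) (N + M) (opQ N) ?_
      rw [eval_shiftedVar, eval_shiftedVar]
      intro h0
      refine hne a b h ?_
      have : ((content lam mu a + content lam mu b + (N : ℤ) + (M : ℤ) - 1 : ℤ) : ℂ) = 0 := by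
        push_cast at h0 ⊢
        linear_combination h0
      exact_mod_cast this
    · exact hasValueAt_one _
  have hleft : HasValueAt (fusionQ lam mu N M * fusionP lam mu N) (fun _ => -1 / 2)
      (((columnPairs lam mu).map (factorQ lam mu N M)).prod * opE lam mu N) := by
    have e : ((columnPairs lam mu).map (factorQ lam mu N M)).prod = _ :=
      prod_columnPairs_eq_tri lam mu (factorQ lam mu N M)
    rw [hfus.1, e]
    exact (HasValueAt.tri (List.nodup_finRange _) fun a _ b _ _ => hQ a b).mul (hE' _)
  -- The two products are values at the same point of one rational function, `K R = R K'` with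
  -- in-column factors removed, so they agree by uniqueness of the value.
  refine ⟨hE', hne, hleft, hleft.unique ?_, ?_⟩
  · have e : ((columnPairs lam mu).reverse.map (factorQ lam mu N M)).prod = _ :=
      prod_columnPairs_reverse_eq_triRev lam mu (factorQ lam mu N M)
    rw [hfus.1, hfus.2, e]
    exact (hE' _).mul (HasValueAt.triRev (List.nodup_finRange _) fun a _ b _ _ => hQ a b)
  · have hmem : columnProduct (fun k => (content lam mu k : ℂ)) (opP N) LL ∈
        brauerAlgebra N (size lam mu) :=
      columnProduct_mem (B := Op N (size lam mu)) (S := brauerAlgebra N (size lam mu))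
        (fun k => (content lam mu k : ℂ)) (p := opP N) (opP_mem_brauerAlgebra N) LL
    rw [opF, hE]
    refine Subalgebra.mul_mem _ (Subalgebra.list_prod_mem _ fun x hx => ?_)
      hmem
    obtain ⟨q, hq, rfl⟩ := List.mem_map.1 hx
    exact factorQ_mem_brauerAlgebra lam mu N M (lt_of_mem_columnPairs hq)
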